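/- Let $0<l<L$ and let $\mathbf{D}\subset\mathbb{C}$ be an open rectangle with side lengths $l$ and $L$. Let $G_{\mathbf{D}}(z,w)=\log|z-w|+K_{\mathbf{D}}(z,w)$ be the Green function of $\mathbf{D}$, where for each $w\in\mathbf{D}$ the function $K_{\mathbf{D}}(\cdot,w)$ is harmonic in $\mathbf{D}$ and $G_{\mathbf{D}}(z,w)\to 0$ as $z\to\partial\mathbf{D}$, and let $\mathcal{R}_{\mathbf{D}}(z)=K_{\mathbf{D}}(z,z)$ be the Robin function of $\mathbf{D}$. Then $\mathcal{R}_{\mathbf{D}}$ has exactly one critical point $\xi_0\in\mathbf{D}$, there is a conformal mapping (holomorphic bijection) $F$ from the open unit disc $\mathbb{D}$ onto $\mathbf{D}$ with $F(0)=\xi_0$, and every such $F$ satisfies the equivalence: the non-degeneracy condition $$\left|\frac{F^{(3)}(0)}{F'(0)}\right|\notin\left\{2\sqrt{1-\tfrac{1}{n^2}}\,:\ n\in\mathbb{N},\ n\geq 1\right\}$$ holds if and only if $$\frac{l}{L}\notin\left\{G_n\,:\ n\in\mathbb{N},\ n\geq 1\right\},\qquad G_n=G\left(\sqrt{\frac{1+\sqrt{1-\frac{1}{n^2}}}{2}}\right),$$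 where, for $0<x<1$, $$G(x)=\frac{K\big(\sqrt{1-x^2}\big)}{K(x)},\qquad K(x)=\int_0^{\pi/2}\frac{d\varphi}{\sqrt{1-x^2\sin^2\varphi}}.$$ -/

import Mathlib

open Set Filter Topology

noncomputable section

/-- The open rectangle with one vertex at `p`, whose sides of length `L` are parallel to the unit
vector `u` and whose sides of length `l` are parallel to `I * u`. As `p` ranges over `ℂ` and `u`
over the unit circle, these are all the open rectangles of the plane with sides `l` and `L`. -/
def openRectangle (p u : ℂ) (L l : ℝ) : Set ℂ :=
  {z | ∃ s ∈ Ioo (0 : ℝ) L, ∃ t ∈ Ioo (0 : ℝ) l, z = p + u * ((s : ℂ) + (t : ℂ) * Complex.I)}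

/-- `K` is the regular part of the Green function `G(z, w) = log |z - w| + K(z, w)` of the
Dirichlet Laplacian (normalized by `Δ_z G(z, w) = 2π δ_w`) on the bounded domain `D`: for every pole
`w ∈ D` the function `z ↦ K(z, w)` is harmonic in all of `D` (the pole included), and
`G(z, w) → 0` as `z ∈ D` tends to any boundary point. -/
def IsGreenRegularPart (D : Set ℂ) (K : ℂ → ℂ → ℝ) : Prop :=
  ∀ w ∈ D, InnerProductSpace.HarmonicOnNhd (fun z => K z w) D ∧
    ∀ ζ ∈ frontier D, Tendsto (fun z => Real.log ‖z - w‖ + K z w) (𝓝[D] ζ) (𝓝 0)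

/-- `R` is (on the bounded domain `D`) the Robin function of `D`: the restriction to the diagonal
of the regular part of the Green function. -/
def IsRobinFunction (D : Set ℂ) (R : ℂ → ℝ) : Prop :=
  ∃ K : ℂ → ℂ → ℝ, IsGreenRegularPart D K ∧ ∀ z ∈ D, R z = K z z

/-- `ξ` is a critical point of the Robin function of `D` (regarded as a function of two real
variables). -/
def IsRobinCriticalPoint (D : Set ℂ) (ξ : ℂ) : Prop :=
  ξ ∈ D ∧ ∃ R : ℂ → ℝ, IsRobinFunction D R ∧ HasFDerivAt R (0 : ℂ →L[ℝ] ℝ) ξ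

/-- `F` restricts to a conformal mapping (a holomorphic bijection) of the open unit disc
onto `D`. -/
def IsConformalDiscMap (F : ℂ → ℂ) (D : Set ℂ) : Prop :=
  DifferentiableOn ℂ F (Metric.ball 0 1) ∧ BijOn F (Metric.ball 0 1) D

/-- The non-degeneracy condition
`|F⁽³⁾(0) / F'(0)| ∉ {2 √(1 - 1/n²) : n = 1, 2, 3, …}`. -/
def NonDegenerate (F : ℂ → ℂ) : Prop :=
  ‖iteratedDeriv 3 F 0 / deriv F 0‖ ∉
    {x : ℝ | ∃ n : ℕ, 1 ≤ n ∧ x = 2 * √(1 - 1 / (n : ℝ) ^ 2)}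

/-- The complete Legendre elliptic integral of the first kind, as a function of the modulus. -/
def ellipticK (x : ℝ) : ℝ :=
  ∫ φ in (0 : ℝ)..(Real.pi / 2), 1 / √(1 - x ^ 2 * Real.sin φ ^ 2)

/-- The function `G(x) = K(√(1 - x²)) / K(x)`. -/
def modulusG (x : ℝ) : ℝ :=
  ellipticK √(1 - x ^ 2) / ellipticK x

/-- The numbers `G_n = G(√((1 + √(1 - 1/n²)) / 2))`. -/
def rectangleG (n : ℕ) : ℝ :=
  modulusG √((1 + √(1 - 1 / (n : ℝ) ^ 2)) / 2)

end

open scoped ComplexConjugate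
open Metric (ball closedBall)

/-! The problem is transported to the disc. If `f` maps the disc conformally onto `D`, with inverse
`g`, then `log ‖discMobius (g w) (g z)‖` is the Green function, and the maximum principle makes it
the only one. So the Robin function satisfies R(f(b)) = -log(|f'(b)| (1 - |b|²)), and f(b) is
critical iff f''(b)/f'(b) = 2 b̄ / (1 - |b|²) (`IsConformalDiscMap.isRobinFunction_iff`).

For a rectangle, `f` is, up to a similarity, the Schwarz–Christoffel map `scMap θ` with derivative
(z⁴ - 2z² cos 2θ + 1)^(-1/2) (`isConformalDiscMap_scMap`). With this explicit f''/f' the critical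
equation has only the solution b = 0 (`eq_zero_of_scLogDeriv_eq`), so the critical point is unique
and equals f(0).

By the Schwarz lemma every admissible F is `f` precomposed with a rotation, whence |F'''(0)/F'(0)| =
2|cos 2θ| (`norm_iteratedDeriv_three_div_deriv`). The side ratio is G(cos θ) (`ratio_scHalfWidth`).
Since G is strictly decreasing, comparing cos 2θ = 2cos²θ - 1 with √(1 - 1/n²) is the same as
comparing l/L with G_n; l < L puts cos²θ above 1/2 and removes the absolute value. -/

/-! ### Conformal maps of the disc and their inverses -/

/-- An injective holomorphic function has nonvanishing derivative. -/
theorem deriv_ne_zero_of_injOn_nhds {f : ℂ → ℂ} {z₀ : ℂ} {U : Set ℂ} (hf : AnalyticAt ℂ f z₀)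
    (hU : U ∈ 𝓝 z₀) (hinj : InjOn f U) : deriv f z₀ ≠ 0 := by
  have hF : AnalyticAt ℂ (fun z => f z - f z₀) z₀ := hf.sub analyticAt_const
  have hne : ¬ ∀ᶠ z in 𝓝 z₀, f z - f z₀ = 0 := by
    intro h
    have h1 : ∀ᶠ z in 𝓝[≠] z₀, False := by
      filter_upwards [nhdsWithin_le_nhds h, nhdsWithin_le_nhds hU, self_mem_nhdsWithin]
        with z hz hzU hzne
      exact hzne (hinj hzU (mem_of_mem_nhds hU) (sub_eq_zero.1 hz))
    rw [eventually_false_iff_eq_bot] at h1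
    exact (inferInstance : (𝓝[≠] z₀).NeBot).ne h1
  obtain ⟨n, e, he, he0, heq⟩ := hF.exists_eventuallyEq_pow_smul_nonzero_iff.2 hne
  rcases Nat.lt_trichotomy n 1 with hn | rfl | hn
  · obtain rfl : n = 0 := by omega
    have := heq.self_of_nhds
    simp at this
    exact absurd this.symm he0
  · have h1 : HasDerivAt (fun z => (z - z₀) ^ 1 • e z) (e z₀) z₀ := by
      have := ((hasDerivAt_id z₀).sub_const z₀).mul he.differentiableAt.hasDerivAt
      simpa [Function.id_def] using! this
    have h2 : HasDerivAt (fun z => f z - f z₀) (e z₀) z₀ := h1.congr_of_eventuallyEq heq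
    have h3 : deriv (fun z => f z - f z₀) z₀ = deriv f z₀ := by simp
    rw [← h3, h2.deriv]
    exact he0
  · exfalso
    have hn0 : n ≠ 0 := by omega
    -- At a zero of order n ≥ 2, `h` is a local coordinate with f - f(z₀) = h^n · e(z₀). Dividing by
    -- `e z₀` keeps the root's base near 1, off the branch cut. Points where `h` takes the values
    -- ε/2 and ωε/2, with ω a primitive n-th root of unity, then have the same image.
    set h : ℂ → ℂ := fun z => (z - z₀) * (e z / e z₀) ^ ((n : ℂ)⁻¹) with hh
    have hroot : AnalyticAt ℂ (fun z => (e z / e z₀) ^ ((n : ℂ)⁻¹)) z₀ := by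
      refine (he.div_const).cpow analyticAt_const ?_
      simp [he0]
    have hha : AnalyticAt ℂ h z₀ := (analyticAt_id.sub analyticAt_const).mul hroot
    have hd : deriv h z₀ = 1 := by
      have := ((hasDerivAt_id z₀).sub_const z₀).mul hroot.differentiableAt.hasDerivAt
      have h3 : HasDerivAt h 1 z₀ := by
        simpa [Function.id_def, he0, hh] using! this
      exact h3.deriv
    have hmap : map h (𝓝 z₀) = 𝓝 0 := by
      have := hha.hasStrictDerivAt.map_nhds_eq (by rw [hd]; exact one_ne_zero)
      simpa [hh] using this
    have hpow : ∀ z, (z - z₀) ^ n • e z = h z ^ n * e z₀ := by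
      intro z
      simp only [hh, mul_pow, smul_eq_mul, Complex.cpow_nat_inv_pow _ hn0]
      field_simp
    have hV : h '' (U ∩ {z | f z - f z₀ = (z - z₀) ^ n • e z}) ∈ 𝓝 (0 : ℂ) := by
      rw [← hmap]
      exact image_mem_map (inter_mem hU heq)
    obtain ⟨ε, hε, hball⟩ := Metric.mem_nhds_iff.1 hV
    set ω := Complex.exp (2 * Real.pi * Complex.I / n) with hω
    have hprim := Complex.isPrimitiveRoot_exp n hn0
    have hωn : ‖ω‖ = 1 := hprim.norm'_eq_one hn0
    have m1 : ((ε / 2 : ℝ) : ℂ) ∈ ball (0 : ℂ) ε := by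
      rw [mem_ball_zero_iff, Complex.norm_real, Real.norm_of_nonneg (by positivity)]
      linarith
    have m2 : ω * ((ε / 2 : ℝ) : ℂ) ∈ ball (0 : ℂ) ε := by
      rw [mem_ball_zero_iff, norm_mul, hωn, one_mul]
      exact mem_ball_zero_iff.1 m1
    obtain ⟨z₁, ⟨hz₁U, hz₁⟩, h1⟩ := hball m1
    obtain ⟨z₂, ⟨hz₂U, hz₂⟩, h2⟩ := hball m2
    have heq2 : f z₁ - f z₀ = f z₂ - f z₀ := by
      rw [mem_ofPred_eq] at hz₁ hz₂
      rw [hz₁, hz₂, hpow, hpow, h1, h2, mul_pow, hprim.pow_eq_one, one_mul]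
    have h12 : z₁ = z₂ := hinj hz₁U hz₂U (sub_left_injective heq2)
    have : ω * ((ε / 2 : ℝ) : ℂ) = 1 * ((ε / 2 : ℝ) : ℂ) := by rw [← h2, ← h12, h1, one_mul]
    have hε2 : ((ε / 2 : ℝ) : ℂ) ≠ 0 := by
      exact_mod_cast (by positivity : ε / 2 ≠ 0)
    exact hprim.ne_one hn (mul_right_cancel₀ hε2 this)

theorem mem_ball_nhds {z : ℂ} (hz : z ∈ ball (0 : ℂ) 1) : ball (0 : ℂ) 1 ∈ 𝓝 z :=
  Metric.isOpen_ball.mem_nhds hz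

namespace IsConformalDiscMap

variable {F : ℂ → ℂ} {D : Set ℂ}

theorem analyticAt (h : IsConformalDiscMap F D) {z : ℂ} (hz : z ∈ ball (0 : ℂ) 1) :
    AnalyticAt ℂ F z :=
  h.1.analyticAt (mem_ball_nhds hz)

theorem deriv_ne_zero (h : IsConformalDiscMap F D) {z : ℂ} (hz : z ∈ ball (0 : ℂ) 1) :
    deriv F z ≠ 0 :=
  deriv_ne_zero_of_injOn_nhds (h.analyticAt hz) (mem_ball_nhds hz) h.2.injOn

theorem image_mem_nhds (h : IsConformalDiscMap F D) {z : ℂ} (hz : z ∈ ball (0 : ℂ) 1) {N : Set ℂ}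
    (hN : N ∈ 𝓝 z) : F '' N ∈ 𝓝 (F z) := by
  rw [← (h.analyticAt hz).hasStrictDerivAt.map_nhds_eq (h.deriv_ne_zero hz)]
  exact image_mem_map hN

theorem isOpen (h : IsConformalDiscMap F D) : IsOpen D := by
  rw [isOpen_iff_mem_nhds]
  intro y hy
  obtain ⟨z, hz, rfl⟩ := h.2.surjOn hy
  exact mem_of_superset (h.image_mem_nhds hz (mem_ball_nhds hz)) h.2.image_eq.subset

/-- The inverse of a conformal map of the disc is holomorphic. -/
theorem exists_inverse (h : IsConformalDiscMap F D) :
    ∃ g : ℂ → ℂ, MapsTo g D (ball 0 1) ∧ (∀ z ∈ ball (0 : ℂ) 1, g (F z) = z) ∧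
      (∀ y ∈ D, F (g y) = y) ∧ ∀ y ∈ D, HasDerivAt g (deriv F (g y))⁻¹ y := by
  have hinv := h.2.invOn_invFunOn
  have hm : MapsTo (Function.invFunOn F (ball 0 1)) D (ball 0 1) := h.2.surjOn.mapsTo_invFunOn
  set g := Function.invFunOn F (ball 0 1) with hg
  refine ⟨g, hm, hinv.1, hinv.2, fun y hy => ?_⟩
  have hgy := hm hy
  refine HasDerivAt.of_local_left_inverse ?_ (h.analyticAt hgy).differentiableAt.hasDerivAt
    (h.deriv_ne_zero hgy) ?_
  · intro N hN
    have := h.image_mem_nhds hgy (inter_mem hN (mem_ball_nhds hgy))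
    rw [hinv.2 hy] at this
    refine mem_map.2 (mem_of_superset this ?_)
    rintro _ ⟨z, ⟨hzN, hz⟩, rfl⟩
    rw [mem_preimage, hinv.1 hz]
    exact hzN
  · filter_upwards [h.isOpen.mem_nhds hy] with x hx using hinv.2 hx

/-- Properness of `F`: the image of a closed disc of radius r < 1 is a compact subset of `D`, hence
stays away from the frontier point ζ. -/
theorem tendsto_norm_inverse (h : IsConformalDiscMap F D) {g : ℂ → ℂ} (hm : MapsTo g D (ball 0 1))
    (hr : ∀ y ∈ D, F (g y) = y) {ζ : ℂ} (hζ : ζ ∈ frontier D) :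
    Tendsto (fun y => ‖g y‖) (𝓝[D] ζ) (𝓝 1) := by
  have hζD : ζ ∉ D := fun hD => by
    have := hζ.2
    rw [h.isOpen.interior_eq] at this
    exact this hD
  refine tendsto_order.2 ⟨fun r hr1 => ?_, fun r hr1 => ?_⟩
  · have hc : IsCompact (F '' closedBall 0 r) :=
      (isCompact_closedBall (0 : ℂ) r).image_of_continuousOn
        (h.1.continuousOn.mono (Metric.closedBall_subset_ball hr1))
    have hnot : ζ ∉ F '' closedBall 0 r := by
      rintro ⟨z, hz, rfl⟩
      exact hζD (h.2.mapsTo (Metric.closedBall_subset_ball hr1 hz))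
    filter_upwards [self_mem_nhdsWithin, nhdsWithin_le_nhds (hc.isClosed.isOpen_compl.mem_nhds hnot)]
      with y hy hy2
    by_contra hle
    exact hy2 ⟨g y, mem_closedBall_zero_iff.2 (not_lt.1 hle), hr y hy⟩
  · filter_upwards [self_mem_nhdsWithin] with y hy
    exact (mem_ball_zero_iff.1 (hm hy)).trans hr1

end IsConformalDiscMap

/-! ### Möbius transformations and existence of the Green function -/

/-- The Möbius transformation of the unit disc that moves `b` to `0`. -/
noncomputable def discMobius (b y : ℂ) : ℂ := (y - b) / (1 - conj b * y)

theorem one_sub_norm_le_norm_discMobius_den {b y : ℂ} (hy : ‖y‖ ≤ 1) :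
    1 - ‖b‖ ≤ ‖1 - conj b * y‖ := by
  have h1 : ‖conj b * y‖ ≤ ‖b‖ := by
    rw [norm_mul, RCLike.norm_conj]
    exact mul_le_of_le_one_right (norm_nonneg _) hy
  have h2 := norm_sub_norm_le (1 : ℂ) (conj b * y)
  rw [norm_one] at h2
  linarith

theorem discMobius_den_ne_zero {b y : ℂ} (hb : ‖b‖ < 1) (hy : ‖y‖ ≤ 1) : 1 - conj b * y ≠ 0 := by
  have := one_sub_norm_le_norm_discMobius_den (b := b) hy
  exact norm_pos_iff.1 (by linarith)

theorem norm_discMobius_sq {b y : ℂ} (hb : ‖b‖ < 1) (hy : ‖y‖ ≤ 1) :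
    ‖discMobius b y‖ ^ 2 = 1 - (1 - ‖b‖ ^ 2) * (1 - ‖y‖ ^ 2) / ‖1 - conj b * y‖ ^ 2 := by
  have h0 : ‖1 - conj b * y‖ ^ 2 ≠ 0 :=
    pow_ne_zero 2 (norm_ne_zero_iff.2 (discMobius_den_ne_zero hb hy))
  rw [discMobius, norm_div, div_pow, eq_sub_iff_add_eq, ← add_div, div_eq_one_iff_eq h0]
  simp only [Complex.sq_norm, Complex.normSq_apply, Complex.sub_re, Complex.sub_im, Complex.mul_re,
    Complex.mul_im, Complex.conj_re, Complex.conj_im, Complex.one_re, Complex.one_im]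
  ring

/-- In `norm_discMobius_sq` the denominator stays above (1 - ‖b‖)² while the factor 1 - ‖y‖² tends
to 0. This supplies the zero boundary values of the Green function. -/
theorem tendsto_log_norm_discMobius {b : ℂ} (hb : ‖b‖ < 1) {ι : Type*} {l : Filter ι} {y : ι → ℂ}
    (hy1 : ∀ᶠ i in l, ‖y i‖ < 1) (hy : Tendsto (fun i => ‖y i‖) l (𝓝 1)) :
    Tendsto (fun i => Real.log ‖discMobius b (y i)‖) l (𝓝 0) := by
  have hsq : Tendsto (fun i => ‖discMobius b (y i)‖ ^ 2) l (𝓝 1) := by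
    have hlow : Tendsto (fun i => 1 - (1 - ‖b‖ ^ 2) * (1 - ‖y i‖ ^ 2) / (1 - ‖b‖) ^ 2) l (𝓝 1) := by
      have := (((hy.pow 2).const_sub 1).const_mul (1 - ‖b‖ ^ 2)).div_const ((1 - ‖b‖) ^ 2)
      simpa using this.const_sub 1
    have hb2 : 0 < 1 - ‖b‖ ^ 2 := by nlinarith [norm_nonneg b]
    refine tendsto_of_tendsto_of_tendsto_of_le_of_le' hlow tendsto_const_nhds ?_ ?_
    · filter_upwards [hy1] with i hi
      have hy2 : 0 < 1 - ‖y i‖ ^ 2 := by nlinarith [norm_nonneg (y i)]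
      rw [norm_discMobius_sq hb hi.le]
      have h1 := one_sub_norm_le_norm_discMobius_den (b := b) hi.le
      have h2 : 0 < 1 - ‖b‖ := by linarith
      gcongr
    · filter_upwards [hy1] with i hi
      have hy2 : 0 < 1 - ‖y i‖ ^ 2 := by nlinarith [norm_nonneg (y i)]
      rw [norm_discMobius_sq hb hi.le]
      have : 0 ≤ (1 - ‖b‖ ^ 2) * (1 - ‖y i‖ ^ 2) / ‖1 - conj b * y i‖ ^ 2 := by positivity
      linarith
  have hlog := (hsq.log one_ne_zero).div_const 2
  simpa using hlog

theorem hasDerivAt_discMobius_self {b : ℂ} (hb : ‖b‖ < 1) :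
    HasDerivAt (discMobius b) (1 - (‖b‖ : ℂ) ^ 2)⁻¹ b := by
  have h0 := discMobius_den_ne_zero hb hb.le
  have h1 : HasDerivAt (fun y : ℂ => y - b) 1 b := (hasDerivAt_id b).sub_const b
  have h2 : HasDerivAt (fun y : ℂ => 1 - conj b * y) (-(conj b * 1)) b :=
    ((hasDerivAt_id b).const_mul (conj b)).const_sub 1
  have h3 := h1.div h2 h0
  have h4 : conj b * b = (‖b‖ : ℂ) ^ 2 := Complex.conj_mul' b
  refine HasDerivAt.congr_deriv h3 ?_
  rw [sub_self, zero_mul, sub_zero, one_mul, h4]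
  rw [h4] at h0
  field_simp

theorem differentiableAt_discMobius {b y : ℂ} (hb : ‖b‖ < 1) (hy : ‖y‖ ≤ 1) :
    DifferentiableAt ℂ (discMobius b) y := by
  have h0 := discMobius_den_ne_zero hb hy
  unfold discMobius
  fun_prop (disch := assumption)

theorem discMobius_self (b : ℂ) : discMobius b b = 0 := by simp [discMobius]

/-- The conformal image of the disc has a Green function, whose Robin function is given by the
conformal radius. -/
theorem IsConformalDiscMap.exists_isGreenRegularPart {F : ℂ → ℂ} {D : Set ℂ}
    (h : IsConformalDiscMap F D) :
    ∃ K : ℂ → ℂ → ℝ, IsGreenRegularPart D K ∧ ∀ b ∈ ball (0 : ℂ) 1,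
      K (F b) (F b) = -Real.log (‖deriv F b‖ * (1 - ‖b‖ ^ 2)) := by
  obtain ⟨g, hm, hl, hr, hg⟩ := h.exists_inverse
  have hDo := h.isOpen
  have hgn : ∀ {y}, y ∈ D → ‖g y‖ < 1 := fun hy => mem_ball_zero_iff.1 (hm hy)
  set B : ℂ → ℂ → ℂ := fun w z => discMobius (g w) (g z) with hB
  have hBd : ∀ w ∈ D, DifferentiableOn ℂ (B w) D := fun w hw z hz =>
    ((differentiableAt_discMobius (hgn hw) (hgn hz).le).comp z
      (hg z hz).differentiableAt).differentiableWithinAt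
  have hBw : ∀ w, B w w = 0 := fun w => discMobius_self _
  have hderiv : ∀ w ∈ D, HasDerivAt (B w) ((1 - (‖g w‖ : ℂ) ^ 2)⁻¹ * (deriv F (g w))⁻¹) w :=
    fun w hw => (hasDerivAt_discMobius_self (hgn hw)).comp w (hg w hw)
  have hpos : ∀ w ∈ D, 0 < 1 - ‖g w‖ ^ 2 := fun w hw => by
    nlinarith [hgn hw, norm_nonneg (g w)]
  have hQw : ∀ w ∈ D, dslope (B w) w w = (1 - (‖g w‖ : ℂ) ^ 2)⁻¹ * (deriv F (g w))⁻¹ :=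
    fun w hw => by rw [dslope_same, (hderiv w hw).deriv]
  have hpos' : ∀ w ∈ D, (1 - (‖g w‖ : ℂ) ^ 2) ≠ 0 := fun w hw => by
    exact_mod_cast (hpos w hw).ne'
  -- `dslope` divides out the simple zero of `B w` at `w`, so off the pole this is log‖B w z‖ -
  -- log‖z - w‖, and at the pole it is log of the modulus of the derivative of `B w`.
  refine ⟨fun z w => Real.log ‖dslope (B w) w z‖, fun w hw => ⟨?_, ?_⟩, ?_⟩
  · intro z hz
    have hQ : DifferentiableOn ℂ (dslope (B w) w) D :=
      (Complex.differentiableOn_dslope (hDo.mem_nhds hw)).2 (hBd w hw)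
    refine (hQ.analyticAt (hDo.mem_nhds hz)).harmonicAt_log_norm ?_
    by_cases hzw : z = w
    · rw [hzw, hQw w hw]
      exact mul_ne_zero (inv_ne_zero (hpos' w hw)) (inv_ne_zero (h.deriv_ne_zero (hm hw)))
    · rw [dslope_of_ne _ hzw, slope_def_field, hBw, sub_zero]
      refine div_ne_zero (div_ne_zero ?_ (discMobius_den_ne_zero (hgn hw) (hgn hz).le))
        (sub_ne_zero.2 hzw)
      refine sub_ne_zero.2 fun hgz => hzw ?_
      rw [← hr z hz, ← hr w hw, hgz]
  · intro ζ hζ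
    have hζD : ζ ∉ D := fun hD => by
      have := hζ.2
      rw [hDo.interior_eq] at this
      exact this hD
    have hζw : ζ ≠ w := fun h => hζD (h ▸ hw)
    have hev1 : ∀ᶠ z in 𝓝[D] ζ, ‖g z‖ < 1 := by
      filter_upwards [self_mem_nhdsWithin] with z hz using hgn hz
    have := tendsto_log_norm_discMobius (hgn hw) hev1 (h.tendsto_norm_inverse hm hr hζ)
    refine this.congr' ?_
    filter_upwards [self_mem_nhdsWithin, nhdsWithin_le_nhds (isOpen_ne.mem_nhds hζw)] with z hz hzw
    have hne : z - w ≠ 0 := sub_ne_zero.2 hzw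
    have hB0 : B w z ≠ 0 := by
      refine div_ne_zero ?_ (discMobius_den_ne_zero (hgn hw) (hgn hz).le)
      refine sub_ne_zero.2 fun hgz => hzw ?_
      rw [← hr z hz, ← hr w hw, hgz]
    rw [dslope_of_ne _ hzw, slope_def_field, hBw, sub_zero, norm_div,
      Real.log_div (norm_ne_zero_iff.2 hB0) (norm_ne_zero_iff.2 hne)]
    simp [hB]
  · intro b hb
    have hD := h.2.mapsTo hb
    have h1 := hpos (F b) hD
    simp only
    rw [hQw (F b) hD, hl b hb, ← mul_inv, norm_inv, Real.log_inv, norm_mul, mul_comm]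
    rw [hl b hb] at h1
    congr 3
    have h2 : (1 - (‖b‖ : ℂ) ^ 2) = ((1 - ‖b‖ ^ 2 : ℝ) : ℂ) := by push_cast; rfl
    rw [h2, Complex.norm_real, Real.norm_of_nonneg h1.le]

/-! ### Maximum principle and uniqueness of the Robin function -/

/-- Weak maximum principle for harmonic functions with nonpositive boundary limits. -/
theorem harmonicOnNhd_nonpos_of_tendsto_frontier {D : Set ℂ} (hDo : IsOpen D)
    (hDb : Bornology.IsBounded D) {H : ℂ → ℝ} (hH : InnerProductSpace.HarmonicOnNhd H D)
    (hlim : ∀ ζ ∈ frontier D, Tendsto H (𝓝[D] ζ) (𝓝 0)) : ∀ z ∈ D, H z ≤ 0 := by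
  by_contra! hcon
  obtain ⟨z₀, hz₀, hpos⟩ := hcon
  classical
  set E : ℂ → ℝ := D.indicator H with hE
  have hHc : ∀ z ∈ D, ContinuousAt H z := fun z hz => (hH z hz).1.continuousAt
  have hEc : ContinuousOn E (closure D) := by
    intro z hz
    by_cases hzD : z ∈ D
    · refine ContinuousAt.continuousWithinAt ((hHc z hzD).congr ?_)
      filter_upwards [hDo.mem_nhds hzD] with y hy
      rw [hE, indicator_of_mem hy]
    · have hζ : z ∈ frontier D := by
        rw [frontier, hDo.interior_eq]
        exact ⟨hz, hzD⟩
      have h0 : E z = 0 := indicator_of_notMem hzD _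
      have h1 : Tendsto E (𝓝[D] z) (𝓝 0) := by
        refine (hlim z hζ).congr' ?_
        filter_upwards [self_mem_nhdsWithin] with y hy
        rw [hE, indicator_of_mem hy]
      have h2 : Tendsto E (𝓝[Dᶜ] z) (𝓝 0) := by
        refine tendsto_const_nhds.congr' ?_
        filter_upwards [self_mem_nhdsWithin] with y hy
        rw [hE, indicator_of_notMem hy]
      have h3 : Tendsto E (𝓝 z) (𝓝 0) := by
        have := h1.sup h2
        rwa [← nhdsWithin_union, union_compl_self, nhdsWithin_univ] at this
      rw [ContinuousWithinAt, h0]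
      exact h3.mono_left nhdsWithin_le_nhds
  have hcpt : IsCompact (closure D) := hDb.isCompact_closure
  obtain ⟨z₁, hz₁, hmax⟩ := hcpt.exists_isMaxOn ⟨z₀, subset_closure hz₀⟩ hEc
  have hmax' : ∀ z ∈ closure D, E z ≤ E z₁ := fun z hz => hmax hz
  have hM : 0 < E z₁ := by
    have := hmax' z₀ (subset_closure hz₀)
    rw [hE, indicator_of_mem hz₀] at this
    exact hpos.trans_le this
  set S : Set ℂ := closure D ∩ E ⁻¹' {E z₁} with hS
  have hSc : IsCompact S :=
    hcpt.of_isClosed_subset (hEc.preimage_isClosed_of_isClosed isClosed_closure isClosed_singleton)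
      inter_subset_left
  -- Take the maximum point with the largest real part. It is interior, as `E` vanishes off `D`; the
  -- maximum modulus principle for exp P makes `E` constant nearby, so a point further to the right
  -- is also a maximum point.
  obtain ⟨z₂, hz₂, hre⟩ := hSc.exists_isMaxOn ⟨z₁, hz₁, rfl⟩ Complex.continuous_re.continuousOn
  have hz₂D : z₂ ∈ D := by
    by_contra hn
    have h0 : E z₂ = 0 := indicator_of_notMem hn _
    have h1 : E z₂ = E z₁ := hz₂.2
    linarith
  obtain ⟨r, hr, hrD⟩ := Metric.isOpen_iff.1 hDo z₂ hz₂D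
  obtain ⟨P, hP, hPre⟩ :=
    InnerProductSpace.HarmonicOnNhd.exists_analyticOnNhd_ball_re_eq (fun y hy => hH y (hrD hy))
  have hnorm : ∀ y ∈ ball z₂ r, ‖Complex.exp (P y)‖ = Real.exp (E y) := by
    intro y hy
    rw [Complex.norm_exp, hE, indicator_of_mem (hrD hy), ← hPre hy]
  have hball : ball z₂ r ∈ 𝓝 z₂ := Metric.ball_mem_nhds z₂ hr
  have hloc : IsLocalMax (norm ∘ fun y => Complex.exp (P y)) z₂ := by
    filter_upwards [hball] with y hy
    rw [Function.comp_apply, Function.comp_apply, hnorm y hy, hnorm z₂ (mem_of_mem_nhds hball),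
      Real.exp_le_exp, show E z₂ = E z₁ from hz₂.2]
    exact hmax' y (subset_closure (hrD hy))
  have hdiff : ∀ᶠ y in 𝓝 z₂, DifferentiableAt ℂ (fun y => Complex.exp (P y)) y := by
    filter_upwards [hball] with y hy
    exact (hP y hy).differentiableAt.cexp
  have hconst := Complex.norm_eventually_eq_of_isLocalMax hdiff hloc
  obtain ⟨δ, hδ, hδb⟩ := Metric.eventually_nhds_iff_ball.1 (hconst.and hball)
  have hy : z₂ + ((δ / 2 : ℝ) : ℂ) ∈ ball z₂ δ := by
    rw [Metric.mem_ball, dist_eq_norm, add_sub_cancel_left, Complex.norm_real,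
      Real.norm_of_nonneg (by positivity)]
    linarith
  obtain ⟨he, hb⟩ := hδb _ hy
  rw [hnorm _ hb, hnorm z₂ (mem_of_mem_nhds hball), Real.exp_eq_exp] at he
  have hin : z₂ + ((δ / 2 : ℝ) : ℂ) ∈ S :=
    ⟨subset_closure (hrD hb), he.trans hz₂.2⟩
  have := hre hin
  simp only [mem_ofPred_eq, Complex.add_re, Complex.ofReal_re] at this
  linarith

/-- The logarithms cancel in the difference of two regular parts, which is therefore harmonic with
zero boundary limits; the maximum principle applies to it and to its negative. -/
theorem IsGreenRegularPart.eq_of_mem {D : Set ℂ} (hDo : IsOpen D) (hDb : Bornology.IsBounded D)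
    {K₁ K₂ : ℂ → ℂ → ℝ} (h₁ : IsGreenRegularPart D K₁) (h₂ : IsGreenRegularPart D K₂) {z w : ℂ}
    (hz : z ∈ D) (hw : w ∈ D) : K₁ z w = K₂ z w := by
  have key : ∀ {K₁ K₂ : ℂ → ℂ → ℝ}, IsGreenRegularPart D K₁ → IsGreenRegularPart D K₂ →
      K₁ z w - K₂ z w ≤ 0 := by
    intro K₁ K₂ h₁ h₂
    refine harmonicOnNhd_nonpos_of_tendsto_frontier hDo hDb ((h₁ w hw).1.sub (h₂ w hw).1)
      (fun ζ hζ => ?_) z hz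
    have := ((h₁ w hw).2 ζ hζ).sub ((h₂ w hw).2 ζ hζ)
    rw [sub_zero] at this
    refine this.congr fun y => ?_
    simp
  linarith [key h₁ h₂, key h₂ h₁]

theorem IsConformalDiscMap.isRobinFunction_iff {F : ℂ → ℂ} {D : Set ℂ}
    (h : IsConformalDiscMap F D) (hDb : Bornology.IsBounded D) {R : ℂ → ℝ} :
    IsRobinFunction D R ↔
      ∀ b ∈ ball (0 : ℂ) 1, R (F b) = -Real.log (‖deriv F b‖ * (1 - ‖b‖ ^ 2)) := by
  obtain ⟨K, hK, hKd⟩ := h.exists_isGreenRegularPart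
  constructor
  · rintro ⟨K', hK', hR⟩ b hb
    have hD := h.2.mapsTo hb
    rw [hR _ hD, hK'.eq_of_mem h.isOpen hDb hK hD hD, hKd b hb]
  · intro hR
    refine ⟨K, hK, fun z hz => ?_⟩
    obtain ⟨b, hb, rfl⟩ := h.2.surjOn hz
    rw [hR b hb, hKd b hb]

/-! ### Rotations and the Schwarz lemma -/

/-- Two conformal maps of the disc onto the same domain that agree at the centre differ by a
rotation. -/
theorem IsConformalDiscMap.exists_rotation {F f : ℂ → ℂ} {D : Set ℂ} (hF : IsConformalDiscMap F D)
    (hf : IsConformalDiscMap f D) (h0 : F 0 = f 0) :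
    ∃ C : ℂ, ‖C‖ = 1 ∧ EqOn F (fun z => f (C * z)) (ball 0 1) := by
  obtain ⟨G, hGm, hGl, hGr, hGd⟩ := hF.exists_inverse
  obtain ⟨g, hgm, hgl, hgr, hgd⟩ := hf.exists_inverse
  have h00 : (0 : ℂ) ∈ ball (0 : ℂ) 1 := Metric.mem_ball_self one_pos
  have hσd : DifferentiableOn ℂ (g ∘ F) (ball 0 1) := fun z hz =>
    ((hgd _ (hF.2.mapsTo hz)).differentiableAt.comp z
      (hF.analyticAt hz).differentiableAt).differentiableWithinAt
  have hτd : DifferentiableOn ℂ (G ∘ f) (ball 0 1) := fun z hz =>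
    ((hGd _ (hf.2.mapsTo hz)).differentiableAt.comp z
      (hf.analyticAt hz).differentiableAt).differentiableWithinAt
  have hσm : MapsTo (g ∘ F) (ball 0 1) (ball 0 1) := hgm.comp hF.2.mapsTo
  have hτm : MapsTo (G ∘ f) (ball 0 1) (ball 0 1) := hGm.comp hf.2.mapsTo
  have hσ0 : (g ∘ F) 0 = 0 := by rw [Function.comp_apply, h0, hgl 0 h00]
  have hτ0 : (G ∘ f) 0 = 0 := by rw [Function.comp_apply, ← h0, hGl 0 h00]
  have hτσ : ∀ z ∈ ball (0 : ℂ) 1, (G ∘ f) ((g ∘ F) z) = z := fun z hz => by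
    simp only [Function.comp_apply]
    rw [hgr _ (hF.2.mapsTo hz), hGl z hz]
  -- The Schwarz lemma for `g ∘ F` and for its inverse `G ∘ f` forces equality of norms; the
  -- equality case, read off at the single point 1/2, makes `g ∘ F` a rotation.
  have hnorm : ∀ z ∈ ball (0 : ℂ) 1, ‖(g ∘ F) z‖ = ‖z‖ := by
    intro z hz
    refine le_antisymm ?_ ?_
    · exact Complex.norm_le_norm_of_mapsTo_ball hσd (hσm.mono_right Metric.ball_subset_closedBall)
        hσ0 (mem_ball_zero_iff.1 hz)
    · have := Complex.norm_le_norm_of_mapsTo_ball hτd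
        (hτm.mono_right Metric.ball_subset_closedBall) hτ0 (mem_ball_zero_iff.1 (hσm hz))
      rwa [hτσ z hz] at this
  have hhalf : (1 / 2 : ℂ) ∈ ball (0 : ℂ) 1 := by
    rw [mem_ball_zero_iff]
    norm_num
  have hslope : ‖dslope (g ∘ F) 0 (1 / 2)‖ = 1 / 1 := by
    rw [dslope_of_ne _ (by norm_num), slope_def_field, hσ0, sub_zero, norm_div, hnorm _ hhalf]
    norm_num
  obtain ⟨C, hC, hCeq⟩ := Complex.affine_of_mapsTo_ball_of_exists_norm_dslope_eq_div' hσd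
    (R₂ := 1) (by rw [hσ0]; exact hσm.mono_right Metric.ball_subset_closedBall)
    ⟨1 / 2, hhalf, hslope⟩
  refine ⟨C, by simpa using hC, fun z hz => ?_⟩
  have := hCeq hz
  simp only [hσ0, zero_add, sub_zero, smul_eq_mul] at this
  simp only
  rw [mul_comm, ← this, Function.comp_apply, hgr _ (hF.2.mapsTo hz)]

/-! ### The Schwarz–Christoffel integrand and its primitive -/

/-- The point `e^{2 i θ}` of the unit circle. -/
noncomputable def scRot (θ : ℝ) : ℂ := Complex.exp ((2 * θ : ℝ) * Complex.I)

theorem norm_scRot (θ : ℝ) : ‖scRot θ‖ = 1 := Complex.norm_exp_ofReal_mul_I _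

theorem conj_scRot (θ : ℝ) : conj (scRot θ) = scRot (-θ) := by
  rw [scRot, scRot, ← Complex.exp_conj, map_mul, Complex.conj_ofReal, Complex.conj_I]
  congr 1
  push_cast
  ring

theorem scRot_re (θ : ℝ) : (scRot θ).re = Real.cos (2 * θ) := Complex.exp_ofReal_mul_I_re _

theorem scRot_im (θ : ℝ) : (scRot θ).im = Real.sin (2 * θ) := Complex.exp_ofReal_mul_I_im _

theorem scRot_mul_neg (θ : ℝ) : scRot θ * scRot (-θ) = 1 := by
  rw [scRot, scRot, ← Complex.exp_add, ← Complex.exp_zero]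
  congr 1
  push_cast
  ring

theorem scRot_add_neg (θ : ℝ) : scRot θ + scRot (-θ) = ((2 * Real.cos (2 * θ) : ℝ) : ℂ) := by
  rw [← conj_scRot, Complex.add_conj, scRot_re]

theorem scRot_pi_div_two_sub (θ : ℝ) : scRot (Real.pi / 2 - θ) = -scRot (-θ) := by
  rw [scRot, scRot]
  have : ((2 * (Real.pi / 2 - θ) : ℝ) : ℂ) * Complex.I
      = Real.pi * Complex.I + ((2 * -θ : ℝ) : ℂ) * Complex.I := by
    push_cast
    ring
  rw [this, Complex.exp_add, Complex.exp_pi_mul_I]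
  ring

/-- The logarithm of the Schwarz–Christoffel integrand of the disc with prevertices
`± e^{± i θ}`. -/
noncomputable def scLog (θ : ℝ) (z : ℂ) : ℂ :=
  -(Complex.log (1 - scRot θ * z ^ 2) + Complex.log (1 - scRot (-θ) * z ^ 2)) / 2

/-- The Schwarz–Christoffel integrand `(z⁴ - 2 z² cos 2θ + 1)^{-1/2}` of a rectangle. -/
noncomputable def scDeriv (θ : ℝ) (z : ℂ) : ℂ := Complex.exp (scLog θ z)

/-- The logarithmic derivative of `scDeriv`. -/
noncomputable def scLogDeriv (θ : ℝ) (z : ℂ) : ℂ :=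
  scRot θ * z / (1 - scRot θ * z ^ 2) + scRot (-θ) * z / (1 - scRot (-θ) * z ^ 2)

/-- The Schwarz–Christoffel map of the disc onto a rectangle. -/
noncomputable def scMap (θ : ℝ) (z : ℂ) : ℂ := ∫ t in (0 : ℝ)..1, z * scDeriv θ (t * z)

/-- A star-shaped domain on which `scMap` is holomorphic. -/
def scDomain (θ : ℝ) : Set ℂ :=
  {z | 1 - scRot θ * z ^ 2 ∈ Complex.slitPlane ∧ 1 - scRot (-θ) * z ^ 2 ∈ Complex.slitPlane}

theorem isOpen_scDomain (θ : ℝ) : IsOpen (scDomain θ) :=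
  (Complex.isOpen_slitPlane.preimage (by fun_prop)).inter
    (Complex.isOpen_slitPlane.preimage (by fun_prop))

/-- 1 - a(tz)² is the convex combination of 1 and 1 - az² with weights 1 - t² and t², and the slit
plane is star-shaped about 1. -/
theorem mul_mem_scDomain {θ : ℝ} {z : ℂ} (hz : z ∈ scDomain θ) {t : ℝ} (ht : t ∈ Icc (0 : ℝ) 1) :
    (t : ℂ) * z ∈ scDomain θ := by
  have key : ∀ a : ℂ, 1 - a * z ^ 2 ∈ Complex.slitPlane →
      1 - a * ((t : ℂ) * z) ^ 2 ∈ Complex.slitPlane := by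
    intro a ha
    have h1 := Complex.starConvex_one_slitPlane ha (sub_nonneg.2 (pow_le_one₀ ht.1 ht.2 : t ^ 2 ≤ 1))
      (sq_nonneg t) (sub_add_cancel _ _)
    convert h1 using 1
    simp only [Complex.real_smul]
    push_cast
    ring
  exact ⟨key _ hz.1, key _ hz.2⟩

theorem one_sub_re_pos {w : ℂ} (hw : ‖w‖ ≤ 1) (hw1 : w ≠ 1) : 0 < (1 - w).re := by
  rw [Complex.sub_re, Complex.one_re, sub_pos]
  refine lt_of_le_of_ne ((Complex.re_le_norm w).trans hw) fun h => hw1 ?_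
  have h2 : w.re ^ 2 + w.im ^ 2 ≤ 1 := by
    have := Complex.sq_norm w
    rw [Complex.normSq_apply] at this
    nlinarith [norm_nonneg w]
  rw [h] at h2
  have h3 : w.im = 0 := by nlinarith
  exact Complex.ext h h3

theorem norm_rot_mul_sq (θ : ℝ) (z : ℂ) : ‖scRot θ * z ^ 2‖ = ‖z‖ ^ 2 := by
  rw [norm_mul, norm_scRot, one_mul, norm_pow]

theorem re_pos_of_mem_ball {θ : ℝ} {z : ℂ} (hz : z ∈ ball (0 : ℂ) 1) :
    0 < (1 - scRot θ * z ^ 2).re := by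
  have hz1 := mem_ball_zero_iff.1 hz
  have h2 : ‖scRot θ * z ^ 2‖ < 1 := by
    rw [norm_rot_mul_sq]
    exact pow_lt_one₀ (norm_nonneg z) hz1 two_ne_zero
  refine one_sub_re_pos h2.le fun h => ?_
  rw [h, norm_one] at h2
  exact lt_irrefl _ h2

theorem ball_subset_scDomain (θ : ℝ) : ball (0 : ℂ) 1 ⊆ scDomain θ := fun _ hz =>
  ⟨.inl (re_pos_of_mem_ball hz), .inl (re_pos_of_mem_ball hz)⟩

/-- On the circle only the four prevertices, where z² = e^{±2iθ}, are singular; comparing real parts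
rules out both values at once. -/
theorem mem_scDomain_of_norm_eq_one {θ : ℝ} {z : ℂ} (hz : ‖z‖ = 1)
    (h : (z ^ 2).re ≠ Real.cos (2 * θ)) : z ∈ scDomain θ := by
  have key : ∀ τ : ℝ, (z ^ 2).re ≠ Real.cos (2 * τ) →
      1 - scRot τ * z ^ 2 ∈ Complex.slitPlane := by
    intro τ hτ
    refine .inl (one_sub_re_pos (by rw [norm_rot_mul_sq, hz]; norm_num) fun h1 => hτ ?_)
    have h2 : z ^ 2 = scRot (-τ) := by
      have h3 := scRot_mul_neg τ
      have h4 : scRot τ ≠ 0 := norm_ne_zero_iff.1 (by rw [norm_scRot]; exact one_ne_zero)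
      exact mul_left_cancel₀ h4 (h1.trans h3.symm)
    rw [h2, scRot_re, mul_neg, Real.cos_neg]
  exact ⟨key θ h, key (-θ) (by rwa [mul_neg, Real.cos_neg])⟩

theorem hasDerivAt_scLog {θ : ℝ} {z : ℂ} (hz : z ∈ scDomain θ) :
    HasDerivAt (scLog θ) (scLogDeriv θ z) z := by
  have key : ∀ a : ℂ, 1 - a * z ^ 2 ∈ Complex.slitPlane →
      HasDerivAt (fun z : ℂ => Complex.log (1 - a * z ^ 2))
        (-(a * (2 * z)) / (1 - a * z ^ 2)) z := by
    intro a ha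
    have h1 : HasDerivAt (fun z : ℂ => 1 - a * z ^ 2) (-(a * (2 * z))) z := by
      have := ((hasDerivAt_pow 2 z).const_mul a).const_sub 1
      simpa using this
    exact h1.clog ha
  have h := (((key _ hz.1).add (key _ hz.2)).neg).div_const 2
  refine HasDerivAt.congr_deriv h ?_
  rw [scLogDeriv]
  ring

theorem hasDerivAt_scDeriv {θ : ℝ} {z : ℂ} (hz : z ∈ scDomain θ) :
    HasDerivAt (scDeriv θ) (scDeriv θ z * scLogDeriv θ z) z :=
  (hasDerivAt_scLog hz).cexp

theorem continuousOn_scDeriv (θ : ℝ) : ContinuousOn (scDeriv θ) (scDomain θ) := fun _ hz =>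
  (hasDerivAt_scDeriv hz).continuousAt.continuousWithinAt

theorem continuousOn_scLogDeriv (θ : ℝ) : ContinuousOn (scLogDeriv θ) (scDomain θ) := by
  refine ContinuousOn.add (ContinuousOn.div (by fun_prop) (by fun_prop) fun z hz => ?_)
    (ContinuousOn.div (by fun_prop) (by fun_prop) fun z hz => ?_)
  · exact Complex.slitPlane_ne_zero hz.1
  · exact Complex.slitPlane_ne_zero hz.2

theorem measurable_scMap_integrand (θ : ℝ) (z : ℂ) :
    Measurable (fun t : ℝ => z * scDeriv θ (t * z)) := by
  unfold scDeriv scLog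
  fun_prop

/-- Differentiating under the integral along the segment from 0 to z gives the integrand d/dt (t ·
`scDeriv θ (t z)`), whose integral is the endpoint value. -/
theorem hasDerivAt_scMap {θ : ℝ} {z : ℂ} (hz : z ∈ scDomain θ) :
    HasDerivAt (scMap θ) (scDeriv θ z) z := by
  obtain ⟨ε, hε, hball⟩ := Metric.nhds_basis_closedBall.mem_iff.1 ((isOpen_scDomain θ).mem_nhds hz)
  set F' : ℂ → ℝ → ℂ := fun x t =>
    scDeriv θ (t * x) + t * x * (scDeriv θ (t * x) * scLogDeriv θ (t * x)) with hF'
  have hmaps : MapsTo (fun p : ℂ × ℝ => (p.2 : ℂ) * p.1) (closedBall z ε ×ˢ Icc (0 : ℝ) 1)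
      (scDomain θ) := fun p hp => mul_mem_scDomain (hball hp.1) hp.2
  have hcont : ContinuousOn (fun p : ℂ × ℝ => F' p.1 p.2) (closedBall z ε ×ˢ Icc (0 : ℝ) 1) := by
    have h0 : ContinuousOn (fun p : ℂ × ℝ => (p.2 : ℂ) * p.1) (closedBall z ε ×ˢ Icc (0 : ℝ) 1) := by
      fun_prop
    have h1 := (continuousOn_scDeriv θ).comp h0 hmaps
    have h2 := (continuousOn_scLogDeriv θ).comp h0 hmaps
    exact h1.add (h0.mul (h1.mul h2))
  obtain ⟨C, hC⟩ := ((isCompact_closedBall z ε).prod isCompact_Icc).exists_bound_of_continuousOn hcont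
  have hIoc : ∀ {t : ℝ}, t ∈ uIoc (0 : ℝ) 1 → t ∈ Icc (0 : ℝ) 1 := fun ht => by
    rw [uIoc_of_le zero_le_one] at ht
    exact Ioc_subset_Icc_self ht
  have hsub : closedBall z ε ∈ 𝓝 z := Metric.closedBall_mem_nhds z hε
  have hF'c : ContinuousOn (F' z) (uIcc (0 : ℝ) 1) := by
    rw [uIcc_of_le zero_le_one]
    exact hcont.comp (f := fun t : ℝ => (z, t)) (by fun_prop)
      fun t ht => ⟨mem_of_mem_nhds hsub, ht⟩
  have hcz : ContinuousOn (fun t : ℝ => z * scDeriv θ (t * z)) (uIcc (0 : ℝ) 1) := by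
    rw [uIcc_of_le zero_le_one]
    exact continuousOn_const.mul ((continuousOn_scDeriv θ).comp (by fun_prop)
      fun t ht => mul_mem_scDomain hz ht)
  have hd := intervalIntegral.hasDerivAt_integral_of_dominated_loc_of_deriv_le
    (μ := MeasureTheory.volume) (a := 0) (b := 1)
    (F := fun x t => x * scDeriv θ (t * x)) (F' := F') (bound := fun _ => C) hsub
    (.of_forall fun x => (measurable_scMap_integrand θ x).aestronglyMeasurable)
    hcz.intervalIntegrable
    ((hF'c.intervalIntegrable (μ := MeasureTheory.volume)).def'.aestronglyMeasurable)
    (.of_forall fun t ht x hx => hC (x, t) ⟨hx, hIoc ht⟩)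
    intervalIntegrable_const
    (.of_forall fun t ht x hx => by
      have h1 : HasDerivAt (fun x : ℂ => (t : ℂ) * x) (t : ℂ) x := by
        simpa using (hasDerivAt_id x).const_mul (t : ℂ)
      have h2 := (hasDerivAt_id x).mul
        ((hasDerivAt_scDeriv (mul_mem_scDomain (hball hx) (hIoc ht))).comp x h1)
      refine HasDerivAt.congr_deriv h2 ?_
      simp only [hF', Function.comp_apply, id]
      ring)
  refine HasDerivAt.congr_deriv hd.2 ?_
  have hprim : ∀ t ∈ uIcc (0 : ℝ) 1,
      HasDerivAt (fun t : ℝ => (t : ℂ) * scDeriv θ (t * z)) (F' z t) t := by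
    intro t ht
    rw [uIcc_of_le zero_le_one] at ht
    have h1 : HasDerivAt (fun t : ℝ => (t : ℂ)) 1 t := Complex.ofRealCLM.hasDerivAt
    have h2 : HasDerivAt (fun t : ℝ => (t : ℂ) * z) z t := by simpa using h1.mul_const z
    have h3 := h1.mul ((hasDerivAt_scDeriv (mul_mem_scDomain hz ht)).comp t h2)
    refine HasDerivAt.congr_deriv h3 ?_
    simp only [hF', Function.comp_apply]
    ring
  rw [intervalIntegral.integral_eq_sub_of_hasDerivAt hprim hF'c.intervalIntegrable]
  simp

theorem norm_scDeriv {θ : ℝ} {z : ℂ} (hz : z ∈ scDomain θ) :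
    ‖scDeriv θ z‖ = (‖1 - scRot θ * z ^ 2‖ * ‖1 - scRot (-θ) * z ^ 2‖) ^ (-(1 / 2) : ℝ) := by
  have h1 := norm_pos_iff.2 (Complex.slitPlane_ne_zero hz.1)
  have h2 := norm_pos_iff.2 (Complex.slitPlane_ne_zero hz.2)
  rw [scDeriv, Complex.norm_exp, Real.rpow_def_of_pos (mul_pos h1 h2), Real.log_mul h1.ne' h2.ne',
    scLog]
  congr 1
  have : (-(Complex.log (1 - scRot θ * z ^ 2) + Complex.log (1 - scRot (-θ) * z ^ 2)) / 2).re
      = -((Complex.log (1 - scRot θ * z ^ 2)).re + (Complex.log (1 - scRot (-θ) * z ^ 2)).re) / 2 := by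
    simp
  rw [this, Complex.log_re, Complex.log_re]
  ring

theorem scDeriv_sq {θ : ℝ} {z : ℂ} (hz : z ∈ scDomain θ) :
    scDeriv θ z ^ 2 = ((1 - scRot θ * z ^ 2) * (1 - scRot (-θ) * z ^ 2))⁻¹ := by
  have h1 := Complex.slitPlane_ne_zero hz.1
  have h2 := Complex.slitPlane_ne_zero hz.2
  rw [scDeriv, ← Complex.exp_nat_mul, scLog]
  have : ((2 : ℕ) : ℂ) *
      (-(Complex.log (1 - scRot θ * z ^ 2) + Complex.log (1 - scRot (-θ) * z ^ 2)) / 2)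
      = -(Complex.log (1 - scRot θ * z ^ 2) + Complex.log (1 - scRot (-θ) * z ^ 2)) := by
    push_cast
    ring
  rw [this, Complex.exp_neg, Complex.exp_add, Complex.exp_log h1, Complex.exp_log h2]

theorem scDeriv_ne_zero (θ : ℝ) (z : ℂ) : scDeriv θ z ≠ 0 := Complex.exp_ne_zero _

/-- Each of the two factors has argument in (-π/2, π/2), hence so does the inverse square root of
their product. This positivity is what makes `scMap` injective. -/
theorem scDeriv_re_pos {θ : ℝ} {z : ℂ} (hz : z ∈ ball (0 : ℂ) 1) : 0 < (scDeriv θ z).re := by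
  rw [scDeriv, Complex.exp_re]
  refine mul_pos (Real.exp_pos _) (Real.cos_pos_of_mem_Ioo ?_)
  have h1 := Complex.abs_arg_lt_pi_div_two_iff.2 (.inl (re_pos_of_mem_ball (θ := θ) hz))
  have h2 := Complex.abs_arg_lt_pi_div_two_iff.2 (.inl (re_pos_of_mem_ball (θ := -θ) hz))
  have h3 : (scLog θ z).im
      = -((1 - scRot θ * z ^ 2).arg + (1 - scRot (-θ) * z ^ 2).arg) / 2 := by
    rw [← Complex.log_im, ← Complex.log_im, scLog]
    simp
  rw [h3]
  rw [abs_lt] at h1 h2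
  constructor <;> linarith [h1.1, h1.2, h2.1, h2.2]

theorem mul_mem_ball {z : ℂ} (hz : z ∈ closedBall (0 : ℂ) 1) {t : ℝ} (ht : t ∈ Ico (0 : ℝ) 1) :
    (t : ℂ) * z ∈ ball (0 : ℂ) 1 := by
  rw [mem_ball_zero_iff, norm_mul, Complex.norm_real, Real.norm_of_nonneg ht.1]
  have := mem_closedBall_zero_iff.1 hz
  calc t * ‖z‖ ≤ t * 1 := by gcongr; exact ht.1
    _ < 1 := by linarith [ht.2]

/-- An integrable bound uniform over the closed disc, prevertices included. Both factors have
modulus at least 1 - t. Eliminating z² between them shows that their moduli sum to at least 2 sin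
2θ, so the larger one is at least sin 2θ. -/
theorem norm_scMap_integrand_le {θ : ℝ} (hθ : 0 < Real.sin (2 * θ)) {z : ℂ}
    (hz : z ∈ closedBall (0 : ℂ) 1) {t : ℝ} (ht : t ∈ Ico (0 : ℝ) 1) :
    ‖z * scDeriv θ (t * z)‖ ≤ Real.sin (2 * θ) ^ (-(1 / 2) : ℝ) * (1 - t) ^ (-(1 / 2) : ℝ) := by
  have htz := mul_mem_ball hz ht
  have hz1 := mem_closedBall_zero_iff.1 hz
  have ht1 : 0 < 1 - t := by linarith [ht.2]
  have hlow : ∀ τ : ℝ, 1 - t ≤ ‖1 - scRot τ * (t * z) ^ 2‖ := by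
    intro τ
    have h1 := norm_sub_norm_le (1 : ℂ) (scRot τ * (t * z) ^ 2)
    rw [norm_one, norm_rot_mul_sq, norm_mul, Complex.norm_real, Real.norm_of_nonneg ht.1] at h1
    have h2 : (t * ‖z‖) ^ 2 ≤ t := by
      have h3 : t * ‖z‖ ≤ t := mul_le_of_le_one_right ht.1 hz1
      have h4 : 0 ≤ t * ‖z‖ := mul_nonneg ht.1 (norm_nonneg z)
      nlinarith [ht.1, ht.2]
    linarith
  have hsum : 2 * Real.sin (2 * θ) ≤
      ‖1 - scRot θ * (t * z) ^ 2‖ + ‖1 - scRot (-θ) * (t * z) ^ 2‖ := by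
    have h1 : scRot (-θ) * (1 - scRot θ * (t * z) ^ 2) - scRot θ * (1 - scRot (-θ) * (t * z) ^ 2)
        = scRot (-θ) - scRot θ := by ring
    have h2 := norm_sub_le (scRot (-θ) * (1 - scRot θ * (t * z) ^ 2))
      (scRot θ * (1 - scRot (-θ) * (t * z) ^ 2))
    rw [h1, norm_mul, norm_mul, norm_scRot, norm_scRot, one_mul, one_mul] at h2
    have h3 := Complex.abs_im_le_norm (scRot (-θ) - scRot θ)
    rw [Complex.sub_im, scRot_im, scRot_im, mul_neg, Real.sin_neg] at h3
    have h4 := neg_abs_le (-Real.sin (2 * θ) - Real.sin (2 * θ))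
    linarith
  rw [norm_mul, norm_scDeriv (ball_subset_scDomain θ htz)]
  have hA := hlow θ
  have hB := hlow (-θ)
  set A := ‖1 - scRot θ * (t * z) ^ 2‖
  set B := ‖1 - scRot (-θ) * (t * z) ^ 2‖
  have hAB : Real.sin (2 * θ) * (1 - t) ≤ A * B := by
    rcases le_total A B with h | h
    · nlinarith
    · nlinarith
  calc ‖z‖ * (A * B) ^ (-(1 / 2) : ℝ) ≤ 1 * (A * B) ^ (-(1 / 2) : ℝ) := by
        gcongr
    _ ≤ (Real.sin (2 * θ) * (1 - t)) ^ (-(1 / 2) : ℝ) := by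
        rw [one_mul]
        exact Real.rpow_le_rpow_of_nonpos (mul_pos hθ ht1) hAB (by norm_num)
    _ = _ := Real.mul_rpow hθ.le ht1.le

theorem continuousOn_scMap {θ : ℝ} (hθ : 0 < Real.sin (2 * θ)) :
    ContinuousOn (scMap θ) (closedBall 0 1) := by
  intro z₀ hz₀
  have hIco : ∀ᵐ t : ℝ, t ∈ uIoc (0 : ℝ) 1 → t ∈ Ico (0 : ℝ) 1 := by
    have h1 : ∀ᵐ t : ℝ, t ≠ 1 := MeasureTheory.Measure.ae_ne _ 1
    filter_upwards [h1] with t ht1 ht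
    rw [uIoc_of_le zero_le_one] at ht
    exact ⟨ht.1.le, lt_of_le_of_ne ht.2 ht1⟩
  refine intervalIntegral.continuousWithinAt_of_dominated_interval
    (bound := fun t => Real.sin (2 * θ) ^ (-(1 / 2) : ℝ) * (1 - t) ^ (-(1 / 2) : ℝ))
    (.of_forall fun z => (measurable_scMap_integrand θ z).aestronglyMeasurable) ?_ ?_ ?_
  · filter_upwards [self_mem_nhdsWithin] with z hz
    filter_upwards [hIco] with t ht ht2
    exact norm_scMap_integrand_le hθ hz (ht ht2)
  · have h1 := (intervalIntegral.intervalIntegrable_rpow' (a := 0) (b := 1)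
      (r := -(1 / 2)) (by norm_num)).comp_sub_left 1
    rw [sub_zero, sub_self] at h1
    exact h1.symm.const_mul _
  · filter_upwards [hIco] with t ht ht2
    have hmem := mul_mem_ball hz₀ (ht ht2)
    have h1 := (hasDerivAt_scDeriv (ball_subset_scDomain θ hmem)).continuousAt
    have h2 : ContinuousAt (fun x : ℂ => x * scDeriv θ (t * x)) z₀ :=
      continuousAt_id.mul (ContinuousAt.comp (f := fun x : ℂ => (t : ℂ) * x) h1 (by fun_prop))
    exact h2.continuousWithinAt

theorem scMap_neg (θ : ℝ) (z : ℂ) : scMap θ (-z) = -scMap θ z := by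
  rw [scMap, scMap, ← intervalIntegral.integral_neg]
  congr 1
  funext t
  simp [scDeriv, scLog]

theorem scMap_zero (θ : ℝ) : scMap θ 0 = 0 := by simp [scMap]

/-- Multiplying z by i changes the sign of z² and so exchanges θ with π/2 - θ. Through this symmetry
every statement on real parts yields one on imaginary parts. -/
theorem scDeriv_I_mul (θ : ℝ) (z : ℂ) :
    scDeriv θ (Complex.I * z) = scDeriv (Real.pi / 2 - θ) z := by
  have h1 : scRot (-(Real.pi / 2 - θ)) = -scRot θ := by
    rw [← conj_scRot, scRot_pi_div_two_sub, map_neg, conj_scRot, neg_neg]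
  rw [scDeriv, scDeriv, scLog, scLog, h1, scRot_pi_div_two_sub, mul_pow, Complex.I_sq, add_comm]
  simp only [neg_mul, mul_neg, one_mul]

theorem scMap_I_mul (θ : ℝ) (z : ℂ) :
    scMap θ (Complex.I * z) = Complex.I * scMap (Real.pi / 2 - θ) z := by
  rw [scMap, scMap, ← intervalIntegral.integral_const_mul]
  congr 1
  funext t
  rw [← scDeriv_I_mul]
  rw [show (t : ℂ) * (Complex.I * z) = Complex.I * (t * z) by ring, mul_assoc]

theorem scMap_im (θ : ℝ) (z : ℂ) :
    (scMap θ z).im = (scMap (Real.pi / 2 - θ) (-Complex.I * z)).re := by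
  have h : z = Complex.I * (-Complex.I * z) := by
    rw [← mul_assoc, mul_neg, Complex.I_mul_I, neg_neg, one_mul]
  conv_lhs => rw [h, scMap_I_mul]
  simp

/-! ### Boundary values: the circle goes to the sides of a rectangle -/

theorem sin_two_mul_pos {θ : ℝ} (hθ : θ ∈ Ioo 0 (Real.pi / 2)) : 0 < Real.sin (2 * θ) :=
  Real.sin_pos_of_pos_of_lt_pi (by linarith [hθ.1]) (by linarith [hθ.2])

theorem pi_div_two_sub_mem {θ : ℝ} (hθ : θ ∈ Ioo 0 (Real.pi / 2)) :
    Real.pi / 2 - θ ∈ Ioo 0 (Real.pi / 2) :=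
  ⟨by linarith [hθ.2], by linarith [hθ.1]⟩

theorem cos_two_mul_sub_cos_two_mul (φ θ : ℝ) :
    Real.cos (2 * φ) - Real.cos (2 * θ) = -2 * Real.sin (φ + θ) * Real.sin (φ - θ) := by
  rw [Real.cos_sub_cos]
  ring_nf

theorem exp_mul_I_sq (φ : ℝ) : Complex.exp (φ * Complex.I) ^ 2 = scRot φ := by
  rw [← Complex.exp_nat_mul, scRot]
  congr 1
  push_cast
  ring

theorem exp_mul_I_mem_scDomain {θ φ : ℝ} (h : Real.cos (2 * φ) ≠ Real.cos (2 * θ)) :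
    Complex.exp (φ * Complex.I) ∈ scDomain θ :=
  mem_scDomain_of_norm_eq_one (Complex.norm_exp_ofReal_mul_I φ) (by rwa [exp_mul_I_sq, scRot_re])

theorem hasDerivAt_scMap_exp {θ φ : ℝ} (h : Real.cos (2 * φ) ≠ Real.cos (2 * θ)) :
    HasDerivAt (fun φ : ℝ => scMap θ (Complex.exp (φ * Complex.I)))
      (scDeriv θ (Complex.exp (φ * Complex.I)) * (Complex.exp (φ * Complex.I) * Complex.I)) φ := by
  have h1 : HasDerivAt (fun φ : ℝ => (φ : ℂ) * Complex.I) Complex.I φ := by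
    simpa using (Complex.ofRealCLM.hasDerivAt (x := φ)).mul_const Complex.I
  exact (hasDerivAt_scMap (exp_mul_I_mem_scDomain h)).comp φ h1.cexp

/-- The squared velocity along the circle is real, so each arc between prevertices runs along a
vertical line when it is negative and along a horizontal line when it is positive. -/
theorem scMap_exp_deriv_sq {θ φ : ℝ} (h : Real.cos (2 * φ) ≠ Real.cos (2 * θ)) :
    (scDeriv θ (Complex.exp (φ * Complex.I)) * (Complex.exp (φ * Complex.I) * Complex.I)) ^ 2
      = (((2 * (Real.cos (2 * θ) - Real.cos (2 * φ)))⁻¹ : ℝ) : ℂ) := by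
  have h1 := scRot_mul_neg φ
  have h2 : scRot φ ≠ 0 := norm_ne_zero_iff.1 (by rw [norm_scRot]; exact one_ne_zero)
  have h3 : (1 - scRot θ * scRot φ) * (1 - scRot (-θ) * scRot φ)
      = scRot φ * ((2 * (Real.cos (2 * φ) - Real.cos (2 * θ)) : ℝ) : ℂ) := by
    have h4 := scRot_add_neg θ
    have h5 := scRot_add_neg φ
    push_cast at h4 h5 ⊢
    linear_combination (-1 : ℂ) * scRot φ * h4 + scRot φ * h5 + scRot φ ^ 2 * scRot_mul_neg θ
      - h1
  have h6 : ((2 * (Real.cos (2 * φ) - Real.cos (2 * θ)) : ℝ) : ℂ) ≠ 0 := by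
    exact_mod_cast mul_ne_zero two_ne_zero (sub_ne_zero.2 h)
  rw [mul_pow, mul_pow, Complex.I_sq, scDeriv_sq (exp_mul_I_mem_scDomain h), exp_mul_I_sq, h3,
    mul_inv]
  have h7 : (2 * (Real.cos (2 * θ) - Real.cos (2 * φ)))
      = -(2 * (Real.cos (2 * φ) - Real.cos (2 * θ))) := by ring
  rw [h7, inv_neg, Complex.ofReal_neg, Complex.ofReal_inv]
  field_simp

theorem continuous_scMap_exp {θ : ℝ} (hθ : θ ∈ Ioo 0 (Real.pi / 2)) :
    Continuous (fun φ : ℝ => scMap θ (Complex.exp (φ * Complex.I))) :=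
  (continuousOn_scMap (sin_two_mul_pos hθ)).comp_continuous (by fun_prop)
    fun φ => mem_closedBall_zero_iff.2 (Complex.norm_exp_ofReal_mul_I φ).le

theorem hasDerivAt_scMap_exp_re {θ φ : ℝ} (h : Real.cos (2 * φ) ≠ Real.cos (2 * θ)) :
    HasDerivAt (fun φ : ℝ => (scMap θ (Complex.exp (φ * Complex.I))).re)
      (scDeriv θ (Complex.exp (φ * Complex.I)) * (Complex.exp (φ * Complex.I) * Complex.I)).re φ :=
  Complex.reCLM.hasFDerivAt.comp_hasDerivAt φ (hasDerivAt_scMap_exp h)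

/-- Half of the side of the image rectangle of `scMap θ` parallel to the real axis. -/
noncomputable def scHalfWidth (θ : ℝ) : ℝ := (scMap θ 1).re

theorem scMap_exp_re_of_abs_le {θ : ℝ} (hθ : θ ∈ Ioo 0 (Real.pi / 2)) {φ : ℝ}
    (hφ : φ ∈ Icc (-θ) θ) : (scMap θ (Complex.exp (φ * Complex.I))).re = scHalfWidth θ := by
  have hc : ContinuousOn (fun φ : ℝ => (scMap θ (Complex.exp (φ * Complex.I))).re) (Icc (-θ) θ) :=
    (Complex.continuous_re.comp (continuous_scMap_exp hθ)).continuousOn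
  have hd : ∀ φ ∈ interior (Icc (-θ) θ),
      HasDerivAt (fun φ : ℝ => (scMap θ (Complex.exp (φ * Complex.I))).re) 0 φ := by
    intro φ hφ
    rw [interior_Icc] at hφ
    have hcos : 0 < Real.cos (2 * φ) - Real.cos (2 * θ) := by
      rw [cos_two_mul_sub_cos_two_mul]
      have h1 : 0 < Real.sin (φ + θ) :=
        Real.sin_pos_of_pos_of_lt_pi (by linarith [hφ.1]) (by linarith [hφ.2, hθ.2])
      have h2 : Real.sin (φ - θ) < 0 :=
        Real.sin_neg_of_neg_of_neg_pi_lt (by linarith [hφ.2]) (by linarith [hφ.1, hθ.2])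
      nlinarith
    have hne : Real.cos (2 * φ) ≠ Real.cos (2 * θ) := (sub_pos.1 hcos).ne'
    refine HasDerivAt.congr_deriv (hasDerivAt_scMap_exp_re hne) ?_
    have hsq := scMap_exp_deriv_sq hne
    set d := scDeriv θ (Complex.exp (φ * Complex.I)) * (Complex.exp (φ * Complex.I) * Complex.I)
    have hneg : (2 * (Real.cos (2 * θ) - Real.cos (2 * φ)))⁻¹ < 0 :=
      inv_lt_zero.2 (by linarith)
    have hre := congrArg Complex.re hsq
    have him := congrArg Complex.im hsq
    rw [Complex.ofReal_re, pow_two, Complex.mul_re] at hre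
    rw [Complex.ofReal_im, pow_two, Complex.mul_im] at him
    have h3 : d.re * d.im = 0 := by linarith
    rcases mul_eq_zero.1 h3 with h | h
    · exact h
    · rw [h] at hre
      nlinarith [mul_self_nonneg d.re]
  have hdiff : DifferentiableOn ℝ (fun φ : ℝ => (scMap θ (Complex.exp (φ * Complex.I))).re)
      (interior (Icc (-θ) θ)) := fun φ hφ => (hd φ hφ).differentiableAt.differentiableWithinAt
  have hmono := monotoneOn_of_deriv_nonneg (convex_Icc (-θ) θ) hc hdiff
    fun φ hφ => (hd φ hφ).deriv.ge
  have hanti := antitoneOn_of_deriv_nonpos (convex_Icc (-θ) θ) hc hdiff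
    fun φ hφ => (hd φ hφ).deriv.le
  have h0 : (0 : ℝ) ∈ Icc (-θ) θ := ⟨by linarith [hθ.1], hθ.1.le⟩
  have h1 : (scMap θ (Complex.exp (((0 : ℝ) : ℂ) * Complex.I))).re = scHalfWidth θ := by
    simp [scHalfWidth]
  rw [← h1]
  rcases le_total 0 φ with h | h
  · exact le_antisymm (hanti h0 hφ h) (hmono h0 hφ h)
  · exact le_antisymm (hmono hφ h0 h) (hanti hφ h0 h)

theorem exp_sub_pi_mul_I (φ : ℝ) : Complex.exp (((φ - Real.pi : ℝ) : ℂ) * Complex.I)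
    = -Complex.exp (φ * Complex.I) := by
  push_cast
  rw [sub_mul, Complex.exp_sub, Complex.exp_pi_mul_I, div_neg, div_one]

theorem scHalfWidth_pos {θ : ℝ} (hθ : θ ∈ Ioo 0 (Real.pi / 2)) : 0 < scHalfWidth θ := by
  have hmem : ∀ t ∈ Icc (0 : ℝ) 1, (t : ℂ) ∈ closedBall (0 : ℂ) 1 := fun t ht => by
    rw [mem_closedBall_zero_iff, Complex.norm_real, Real.norm_of_nonneg ht.1]
    exact ht.2
  have hc : ContinuousOn (fun t : ℝ => (scMap θ t).re) (Icc 0 1) :=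
    Complex.continuous_re.comp_continuousOn
      ((continuousOn_scMap (sin_two_mul_pos hθ)).comp (by fun_prop) hmem)
  have hmono := strictMonoOn_of_deriv_pos (convex_Icc 0 1) hc (by
    intro t ht
    rw [interior_Icc] at ht
    have htb : (t : ℂ) ∈ ball (0 : ℂ) 1 := by
      rw [mem_ball_zero_iff, Complex.norm_real, Real.norm_of_nonneg ht.1.le]
      exact ht.2
    have h1 := (hasDerivAt_scMap (ball_subset_scDomain θ htb)).comp_ofReal
    have h2 : HasDerivAt (fun t : ℝ => (scMap θ t).re) (scDeriv θ t).re t :=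
      Complex.reCLM.hasFDerivAt.comp_hasDerivAt t h1
    rw [h2.deriv]
    exact scDeriv_re_pos htb)
  have := hmono ⟨le_rfl, zero_le_one⟩ ⟨zero_le_one, le_rfl⟩ zero_lt_one
  simpa [scMap_zero, scHalfWidth] using this

/-- On the upper arc the squared velocity is positive, so the derivative of the real part never
vanishes. By Darboux it has constant sign, and the real part is monotone between its end values
`scHalfWidth θ` and `-scHalfWidth θ`. -/
theorem abs_scMap_exp_re_le {θ : ℝ} (hθ : θ ∈ Ioo 0 (Real.pi / 2)) {φ : ℝ}
    (hφ : φ ∈ Icc θ (Real.pi - θ)) :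
    |(scMap θ (Complex.exp (φ * Complex.I))).re| ≤ scHalfWidth θ := by
  have hc : ContinuousOn (fun φ : ℝ => (scMap θ (Complex.exp (φ * Complex.I))).re)
      (Icc θ (Real.pi - θ)) :=
    (Complex.continuous_re.comp (continuous_scMap_exp hθ)).continuousOn
  have hne : ∀ φ ∈ Ioo θ (Real.pi - θ), 0 < Real.cos (2 * θ) - Real.cos (2 * φ) := by
    intro φ hφ
    have h0 := cos_two_mul_sub_cos_two_mul φ θ
    have h1 : 0 < Real.sin (φ + θ) :=
      Real.sin_pos_of_pos_of_lt_pi (by linarith [hφ.1, hθ.1]) (by linarith [hφ.2])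
    have h2 : 0 < Real.sin (φ - θ) :=
      Real.sin_pos_of_pos_of_lt_pi (by linarith [hφ.1]) (by linarith [hφ.2, hθ.1])
    nlinarith [mul_pos h1 h2]
  have hd : ∀ φ ∈ Ioo θ (Real.pi - θ), HasDerivAt
      (fun φ : ℝ => (scMap θ (Complex.exp (φ * Complex.I))).re)
      (scDeriv θ (Complex.exp (φ * Complex.I)) * (Complex.exp (φ * Complex.I) * Complex.I)).re φ :=
    fun φ hφ => hasDerivAt_scMap_exp_re (sub_pos.1 (hne φ hφ)).ne
  have hd0 : ∀ φ ∈ Ioo θ (Real.pi - θ),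
      (scDeriv θ (Complex.exp (φ * Complex.I)) *
        (Complex.exp (φ * Complex.I) * Complex.I)).re ≠ 0 := by
    intro φ hφ h
    have hsq := scMap_exp_deriv_sq (sub_pos.1 (hne φ hφ)).ne
    have hre := congrArg Complex.re hsq
    rw [Complex.ofReal_re, pow_two, Complex.mul_re, h] at hre
    have hpos : 0 < (2 * (Real.cos (2 * θ) - Real.cos (2 * φ)))⁻¹ :=
      inv_pos.2 (by linarith [hne φ hφ])
    rw [← hre] at hpos
    nlinarith [mul_self_nonneg (scDeriv θ (Complex.exp (φ * Complex.I)) *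
        (Complex.exp (φ * Complex.I) * Complex.I)).im]
  have hdiff : DifferentiableOn ℝ (fun φ : ℝ => (scMap θ (Complex.exp (φ * Complex.I))).re)
      (interior (Icc θ (Real.pi - θ))) := by
    rw [interior_Icc]
    exact fun φ hφ => (hd φ hφ).differentiableAt.differentiableWithinAt
  have hle : θ ≤ Real.pi - θ := by linarith [hθ.2]
  have hl : θ ∈ Icc θ (Real.pi - θ) := ⟨le_rfl, hle⟩
  have hr : Real.pi - θ ∈ Icc θ (Real.pi - θ) := ⟨hle, le_rfl⟩
  have hvl : (scMap θ (Complex.exp (θ * Complex.I))).re = scHalfWidth θ :=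
    scMap_exp_re_of_abs_le hθ ⟨by linarith [hθ.1], le_rfl⟩
  have hvr : (scMap θ (Complex.exp ((Real.pi - θ : ℝ) * Complex.I))).re = -scHalfWidth θ := by
    have h1 := exp_sub_pi_mul_I (Real.pi - θ)
    rw [show Real.pi - θ - Real.pi = -θ by ring] at h1
    rw [← scMap_exp_re_of_abs_le hθ (φ := -θ) ⟨le_rfl, by linarith [hθ.1]⟩, h1, scMap_neg,
      Complex.neg_re, neg_neg]
  have hX := scHalfWidth_pos hθ
  rcases hasDerivWithinAt_forall_lt_or_forall_gt_of_forall_ne (convex_Ioo θ (Real.pi - θ))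
    (fun φ hφ => (hd φ hφ).hasDerivWithinAt) hd0 with h | h
  · have hanti := antitoneOn_of_deriv_nonpos (convex_Icc θ (Real.pi - θ)) hc hdiff (by
      rw [interior_Icc]
      exact fun φ hφ => ((hd φ hφ).deriv.trans_lt (h φ hφ)).le)
    have h1 := hanti hl hφ hφ.1
    have h2 := hanti hφ hr hφ.2
    simp only at h1 h2
    rw [hvl] at h1
    rw [hvr] at h2
    exact abs_le.2 ⟨h2, h1⟩
  · have hmono := monotoneOn_of_deriv_nonneg (convex_Icc θ (Real.pi - θ)) hc hdiff (by
      rw [interior_Icc]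
      exact fun φ hφ => ((h φ hφ).trans_eq (hd φ hφ).deriv.symm).le)
    have h3 := hmono hl hr hle
    simp only at h3
    rw [hvl, hvr] at h3
    linarith

/-- Up to sign, every point of the unit circle lies on one of two adjacent arcs. -/
theorem exists_exp_of_norm_eq_one (θ : ℝ) {z : ℂ} (hz : ‖z‖ = 1) :
    ∃ φ : ℝ, (φ ∈ Icc (-θ) θ ∨ φ ∈ Icc θ (Real.pi - θ)) ∧
      (z = Complex.exp (φ * Complex.I) ∨ z = -Complex.exp (φ * Complex.I)) := by
  have h0 : z = Complex.exp (z.arg * Complex.I) := by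
    have := Complex.norm_mul_exp_arg_mul_I z
    rw [hz, Complex.ofReal_one, one_mul] at this
    exact this.symm
  have h1 := Complex.neg_pi_lt_arg z
  have h2 := Complex.arg_le_pi z
  rcases le_or_gt z.arg (Real.pi - θ) with h | h
  · rcases le_or_gt θ z.arg with h3 | h3
    · exact ⟨z.arg, .inr ⟨h3, h⟩, .inl h0⟩
    · rcases le_or_gt (-θ) z.arg with h4 | h4
      · exact ⟨z.arg, .inl ⟨h4, h3.le⟩, .inl h0⟩
      · refine ⟨z.arg + Real.pi, ?_, .inr ?_⟩
        · rcases le_total θ (z.arg + Real.pi) with h5 | h5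
          · exact .inr ⟨h5, by linarith⟩
          · exact .inl ⟨by linarith, h5⟩
        · have := exp_sub_pi_mul_I (z.arg + Real.pi)
          rw [add_sub_cancel_right, ← h0] at this
          exact this
  · refine ⟨z.arg - Real.pi, .inl ⟨by linarith, by linarith⟩, .inr ?_⟩
    rw [exp_sub_pi_mul_I, neg_neg, ← h0]

theorem abs_scMap_re_le_of_norm_eq_one {θ : ℝ} (hθ : θ ∈ Ioo 0 (Real.pi / 2)) {z : ℂ}
    (hz : ‖z‖ = 1) : |(scMap θ z).re| ≤ scHalfWidth θ := by
  obtain ⟨φ, hφ, hzφ⟩ := exists_exp_of_norm_eq_one θ hz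
  have key : |(scMap θ (Complex.exp (φ * Complex.I))).re| ≤ scHalfWidth θ := by
    rcases hφ with hφ | hφ
    · rw [scMap_exp_re_of_abs_le hθ hφ, abs_of_pos (scHalfWidth_pos hθ)]
    · exact abs_scMap_exp_re_le hθ hφ
  rcases hzφ with rfl | rfl
  · exact key
  · rwa [scMap_neg, Complex.neg_re, abs_neg]

/-- `scMap θ` maps the unit circle into the boundary of a rectangle. -/
theorem abs_scMap_re_eq_or_abs_scMap_im_eq {θ : ℝ} (hθ : θ ∈ Ioo 0 (Real.pi / 2)) {z : ℂ}
    (hz : ‖z‖ = 1) :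
    |(scMap θ z).re| = scHalfWidth θ ∨ |(scMap θ z).im| = scHalfWidth (Real.pi / 2 - θ) := by
  obtain ⟨φ, hφ, hzφ⟩ := exists_exp_of_norm_eq_one θ hz
  have key : |(scMap θ (Complex.exp (φ * Complex.I))).re| = scHalfWidth θ ∨
      |(scMap θ (Complex.exp (φ * Complex.I))).im| = scHalfWidth (Real.pi / 2 - θ) := by
    rcases hφ with hφ | hφ
    · left
      rw [scMap_exp_re_of_abs_le hθ hφ, abs_of_pos (scHalfWidth_pos hθ)]
    · right
      have hθ' := pi_div_two_sub_mem hθ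
      have h1 : -Complex.I * Complex.exp (φ * Complex.I)
          = Complex.exp ((φ - Real.pi / 2 : ℝ) * Complex.I) := by
        push_cast
        rw [sub_mul, Complex.exp_sub, Complex.exp_pi_div_two_mul_I, Complex.div_I]
        ring
      rw [scMap_im, h1, scMap_exp_re_of_abs_le hθ' ⟨by linarith [hφ.1], by linarith [hφ.2]⟩,
        abs_of_pos (scHalfWidth_pos hθ')]
  rcases hzφ with rfl | rfl
  · exact key
  · rwa [scMap_neg, Complex.neg_re, Complex.neg_im, abs_neg, abs_neg]

/-! ### Bijectivity of the Schwarz–Christoffel map onto the rectangle -/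

theorem differentiableOn_scMap (θ : ℝ) : DifferentiableOn ℂ (scMap θ) (ball 0 1) := fun _ hz =>
  (hasDerivAt_scMap (ball_subset_scDomain θ hz)).differentiableAt.differentiableWithinAt

theorem abs_scMap_re_le {θ : ℝ} (hθ : θ ∈ Ioo 0 (Real.pi / 2)) {z : ℂ}
    (hz : z ∈ closedBall (0 : ℂ) 1) : |(scMap θ z).re| ≤ scHalfWidth θ := by
  have hcl : closure (ball (0 : ℂ) 1) = closedBall 0 1 := closure_ball 0 one_ne_zero
  have key : ∀ z ∈ closedBall (0 : ℂ) 1, (scMap θ z).re ≤ scHalfWidth θ := by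
    intro z hz
    -- The modulus of exp(`scMap`) is the exponential of the real part, so the maximum modulus
    -- principle carries the boundary bound inside; oddness then gives the lower bound.
    have hd : DiffContOnCl ℂ (fun z => Complex.exp (scMap θ z)) (ball 0 1) := by
      refine ⟨(differentiableOn_scMap θ).cexp, ?_⟩
      rw [hcl]
      exact (continuousOn_scMap (sin_two_mul_pos hθ)).cexp
    have := Complex.norm_le_of_forall_mem_frontier_norm_le Metric.isBounded_ball hd
      (C := Real.exp (scHalfWidth θ)) (fun w hw => by
        rw [frontier_ball (0 : ℂ) one_ne_zero] at hw
        rw [Complex.norm_exp, Real.exp_le_exp]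
        exact (le_abs_self _).trans
          (abs_scMap_re_le_of_norm_eq_one hθ (mem_sphere_zero_iff_norm.1 hw)))
      (hcl ▸ hz)
    rwa [Complex.norm_exp, Real.exp_le_exp] at this
  refine abs_le.2 ⟨?_, key z hz⟩
  have := key (-z) (by simpa using hz)
  rw [scMap_neg, Complex.neg_re] at this
  linarith

theorem abs_scMap_im_le {θ : ℝ} (hθ : θ ∈ Ioo 0 (Real.pi / 2)) {z : ℂ}
    (hz : z ∈ closedBall (0 : ℂ) 1) : |(scMap θ z).im| ≤ scHalfWidth (Real.pi / 2 - θ) := by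
  rw [scMap_im]
  exact abs_scMap_re_le (pi_div_two_sub_mem hθ) (by simpa using hz)

/-- A holomorphic function on a convex set whose derivative has positive real part is injective: its
component in the direction z - w strictly increases along the segment from w to z. -/
theorem injOn_scMap (θ : ℝ) : InjOn (scMap θ) (ball 0 1) := by
  intro z hz w hw h
  by_contra hne
  have hseg : ∀ t ∈ Icc (0 : ℝ) 1, w + t * (z - w) ∈ ball (0 : ℂ) 1 := fun t ht => by
    have h1 := (convex_ball (0 : ℂ) 1) hw hz (sub_nonneg.2 ht.2) ht.1 (sub_add_cancel _ _)
    convert h1 using 1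
    simp only [Complex.real_smul]
    push_cast
    ring
  have hd : ∀ t ∈ Icc (0 : ℝ) 1, HasDerivAt
      (fun t : ℝ => (conj (z - w) * scMap θ (w + t * (z - w))).re)
      (Complex.normSq (z - w) * (scDeriv θ (w + t * (z - w))).re) t := by
    intro t ht
    have h1 : HasDerivAt (fun t : ℝ => w + (t : ℂ) * (z - w)) (z - w) t := by
      simpa using ((Complex.ofRealCLM.hasDerivAt (x := t)).mul_const (z - w)).const_add w
    have h2 := ((hasDerivAt_scMap (ball_subset_scDomain θ (hseg t ht))).comp t h1).const_mul
      (conj (z - w))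
    have h3 := Complex.reCLM.hasFDerivAt.comp_hasDerivAt t h2
    refine HasDerivAt.congr_deriv h3 ?_
    rw [mul_left_comm, mul_comm (conj (z - w)), Complex.mul_conj, mul_comm, Complex.reCLM_apply,
      Complex.re_ofReal_mul]
  have hmono := strictMonoOn_of_deriv_pos (convex_Icc (0 : ℝ) 1)
    (fun t ht => (hd t ht).continuousAt.continuousWithinAt) (fun t ht => by
      have ht' := interior_subset ht
      rw [(hd t ht').deriv]
      exact mul_pos (Complex.normSq_pos.2 (sub_ne_zero.2 hne)) (scDeriv_re_pos (hseg t ht')))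
  have := hmono ⟨le_rfl, zero_le_one⟩ ⟨zero_le_one, le_rfl⟩ zero_lt_one
  simp [h] at this

/-- `scMap θ` is a conformal map of the disc onto a centred rectangle. -/
theorem isConformalDiscMap_scMap {θ : ℝ} (hθ : θ ∈ Ioo 0 (Real.pi / 2)) :
    IsConformalDiscMap (scMap θ) (Ioo (-scHalfWidth θ) (scHalfWidth θ) ×ℂ
      Ioo (-scHalfWidth (Real.pi / 2 - θ)) (scHalfWidth (Real.pi / 2 - θ))) := by
  set X := scHalfWidth θ with hX
  set Y := scHalfWidth (Real.pi / 2 - θ) with hY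
  have hXpos : 0 < X := scHalfWidth_pos hθ
  have hYpos : 0 < Y := scHalfWidth_pos (pi_div_two_sub_mem hθ)
  have hopen : IsOpen (scMap θ '' ball 0 1) := by
    rw [isOpen_iff_mem_nhds]
    rintro _ ⟨z, hz, rfl⟩
    have ha := (differentiableOn_scMap θ).analyticAt (mem_ball_nhds hz)
    have hd := (hasDerivAt_scMap (ball_subset_scDomain θ hz)).deriv
    rw [← ha.hasStrictDerivAt.map_nhds_eq (by rw [hd]; exact scDeriv_ne_zero θ z)]
    exact image_mem_map (mem_ball_nhds hz)
  have hmaps : scMap θ '' ball 0 1 ⊆ Ioo (-X) X ×ℂ Ioo (-Y) Y := by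
    rw [← interior_Icc, ← interior_Icc, ← Complex.interior_reProdIm, hopen.subset_interior_iff]
    rintro _ ⟨z, hz, rfl⟩
    have hz' := Metric.ball_subset_closedBall hz
    exact ⟨abs_le.1 (abs_scMap_re_le hθ hz'), abs_le.1 (abs_scMap_im_le hθ hz')⟩
  refine ⟨differentiableOn_scMap θ, fun z hz => hmaps ⟨z, hz, rfl⟩, injOn_scMap θ, ?_⟩
  have hconn : IsPreconnected (Ioo (-X) X ×ℂ Ioo (-Y) Y) :=
    (((convex_Ioo (-X) X).linear_preimage Complex.reLm).inter
      ((convex_Ioo (-Y) Y).linear_preimage Complex.imLm)).isPreconnected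
  -- The image is open and relatively closed in the connected rectangle: a limit point has a
  -- preimage in the closed disc, which is not on the circle because the circle misses the open
  -- rectangle.
  refine hconn.subset_of_closure_inter_subset hopen ?_ ?_
  · refine ⟨0, ⟨⟨?_, ?_⟩, ⟨?_, ?_⟩⟩, 0, Metric.mem_ball_self one_pos, scMap_zero θ⟩ <;> simp <;>
      assumption
  · rintro y ⟨hy, hyR⟩
    have hcpt : IsCompact (scMap θ '' closedBall 0 1) :=
      (isCompact_closedBall (0 : ℂ) 1).image_of_continuousOn
        (continuousOn_scMap (sin_two_mul_pos hθ))
    obtain ⟨z, hz, rfl⟩ := hcpt.isClosed.closure_subset_iff.2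
      (image_mono Metric.ball_subset_closedBall) hy
    refine ⟨z, ?_, rfl⟩
    rw [mem_ball_zero_iff]
    refine lt_of_le_of_ne (mem_closedBall_zero_iff.1 hz) fun h1 => ?_
    have hre := abs_lt.2 hyR.1
    have him := abs_lt.2 hyR.2
    rcases abs_scMap_re_eq_or_abs_scMap_im_eq hθ h1 with h | h
    · exact hre.ne h
    · exact him.ne h

/-! ### Elliptic integrals and the function G -/

theorem one_sub_mul_sin_sq_pos {x : ℝ} (hx : x ^ 2 < 1) (φ : ℝ) :
    0 < 1 - x ^ 2 * Real.sin φ ^ 2 := by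
  nlinarith [Real.sin_sq_le_one φ, sq_nonneg x, sq_nonneg (Real.sin φ)]

theorem continuous_ellipticK_integrand {x : ℝ} (hx : x ^ 2 < 1) :
    Continuous (fun φ : ℝ => 1 / √(1 - x ^ 2 * Real.sin φ ^ 2)) :=
  Continuous.div (by fun_prop) (by fun_prop)
    fun φ => (Real.sqrt_pos.2 (one_sub_mul_sin_sq_pos hx φ)).ne'

theorem ellipticK_lt_ellipticK {x y : ℝ} (hx : 0 ≤ x) (hxy : x < y) (hy : y < 1) :
    ellipticK x < ellipticK y := by
  have hx2 : x ^ 2 < 1 := by nlinarith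
  have hy2 : y ^ 2 < 1 := by nlinarith
  have hlt : x ^ 2 < y ^ 2 := by nlinarith
  refine intervalIntegral.integral_lt_integral_of_continuousOn_of_le_of_exists_lt Real.pi_div_two_pos
    (continuous_ellipticK_integrand hx2).continuousOn
    (continuous_ellipticK_integrand hy2).continuousOn (fun φ _ => ?_)
    ⟨Real.pi / 2, ⟨Real.pi_div_two_pos.le, le_rfl⟩, ?_⟩
  · have := Real.sqrt_pos.2 (one_sub_mul_sin_sq_pos hy2 φ)
    gcongr
  · have h1 := Real.sqrt_pos.2 (one_sub_mul_sin_sq_pos hy2 (Real.pi / 2))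
    refine one_div_lt_one_div_of_lt h1 (Real.sqrt_lt_sqrt (one_sub_mul_sin_sq_pos hy2 _).le ?_)
    rw [Real.sin_pi_div_two]
    linarith

theorem ellipticK_pos {x : ℝ} (hx : x ^ 2 < 1) : 0 < ellipticK x :=
  intervalIntegral.intervalIntegral_pos_of_pos
    ((continuous_ellipticK_integrand hx).intervalIntegrable _ _)
    (fun φ => one_div_pos.2 (Real.sqrt_pos.2 (one_sub_mul_sin_sq_pos hx φ))) Real.pi_div_two_pos

theorem continuousOn_ellipticK {b : ℝ} (hb : b < 1) : ContinuousOn ellipticK (Icc 0 b) := by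
  rcases lt_or_ge b 0 with h0 | h0
  · rw [Icc_eq_empty (not_le.2 h0)]
    exact continuousOn_empty _
  have hb2 : b ^ 2 < 1 := by nlinarith
  -- Capping the squared modulus at b² gives an integrand continuous in both variables on the whole
  -- plane, unchanged for x in [0, b].
  have hpos : ∀ x φ : ℝ, 0 < 1 - min (x ^ 2) (b ^ 2) * Real.sin φ ^ 2 := fun x φ => by
    have h1 := one_sub_mul_sin_sq_pos hb2 φ
    have h2 : min (x ^ 2) (b ^ 2) * Real.sin φ ^ 2 ≤ b ^ 2 * Real.sin φ ^ 2 := by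
      gcongr
      exact min_le_right _ _
    linarith
  have hc : Continuous fun x : ℝ =>
      ∫ φ in (0 : ℝ)..(Real.pi / 2), 1 / √(1 - min (x ^ 2) (b ^ 2) * Real.sin φ ^ 2) := by
    refine intervalIntegral.continuous_parametric_intervalIntegral_of_continuous'
      (f := fun x φ => 1 / √(1 - min (x ^ 2) (b ^ 2) * Real.sin φ ^ 2)) ?_ _ _
    exact Continuous.div (by fun_prop) (by fun_prop) fun p => (Real.sqrt_pos.2 (hpos p.1 p.2)).ne'
  refine hc.continuousOn.congr fun x hx => ?_
  have : min (x ^ 2) (b ^ 2) = x ^ 2 := min_eq_left (pow_le_pow_left₀ hx.1 hx.2 2)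
  simp only [ellipticK, this]

/-- The logarithmic divergence of `K` at modulus `1`, in terms of the complementary modulus. -/
theorem neg_log_le_ellipticK {ε : ℝ} (hε : 0 < ε) (hε1 : ε < 1) :
    -Real.log ε ≤ ellipticK √(1 - ε ^ 2) := by
  have hs : √(1 - ε ^ 2) ^ 2 = 1 - ε ^ 2 := Real.sq_sqrt (by nlinarith)
  have hx : √(1 - ε ^ 2) ^ 2 < 1 := by rw [hs]; nlinarith
  have hpos : ∀ φ ∈ uIcc 0 (Real.pi / 2), 0 < ε + Real.pi / 2 - φ := fun φ hφ => by
    rw [uIcc_of_le Real.pi_div_two_pos.le] at hφ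
    linarith [hφ.2]
  have hcont : ContinuousOn (fun φ => 1 / (ε + Real.pi / 2 - φ)) (uIcc 0 (Real.pi / 2)) :=
    ContinuousOn.div (by fun_prop) (by fun_prop) fun φ hφ => (hpos φ hφ).ne'
  have hint : ∫ φ in (0 : ℝ)..(Real.pi / 2), 1 / (ε + Real.pi / 2 - φ)
      = -Real.log ε + Real.log (ε + Real.pi / 2) := by
    have hd : ∀ φ ∈ uIcc 0 (Real.pi / 2),
        HasDerivAt (fun φ => -Real.log (ε + Real.pi / 2 - φ)) (1 / (ε + Real.pi / 2 - φ)) φ := by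
      intro φ hφ
      have h1 := (((hasDerivAt_id φ).const_sub (ε + Real.pi / 2)).log (hpos φ hφ).ne').neg
      refine HasDerivAt.congr_deriv h1 ?_
      simp only [id]
      ring
    rw [intervalIntegral.integral_eq_sub_of_hasDerivAt hd hcont.intervalIntegrable]
    simp
  have hlog : 0 ≤ Real.log (ε + Real.pi / 2) := Real.log_nonneg (by linarith [Real.pi_gt_three])
  -- The radicand equals cos²φ + ε² sin²φ, which is at most (π/2 - φ + ε)² because 0 ≤ cos φ ≤ π/2 -
  -- φ.
  have hle : ∫ φ in (0 : ℝ)..(Real.pi / 2), 1 / (ε + Real.pi / 2 - φ) ≤ ellipticK √(1 - ε ^ 2) := by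
    refine intervalIntegral.integral_mono_on Real.pi_div_two_pos.le hcont.intervalIntegrable
      ((continuous_ellipticK_integrand hx).intervalIntegrable _ _) fun φ hφ => ?_
    refine one_div_le_one_div_of_le (Real.sqrt_pos.2 (one_sub_mul_sin_sq_pos hx φ)) ?_
    have h0 : 0 ≤ Real.pi / 2 - φ := by linarith [hφ.2]
    refine Real.sqrt_le_iff.2 ⟨by linarith, ?_⟩
    have h1 : Real.cos φ ≤ Real.pi / 2 - φ := by
      rw [← Real.sin_pi_div_two_sub]
      exact Real.sin_le h0
    have h2 : 0 ≤ Real.cos φ := Real.cos_nonneg_of_mem_Icc ⟨by linarith [hφ.1, Real.pi_pos], hφ.2⟩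
    have h3 := Real.sin_sq_add_cos_sq φ
    rw [hs]
    nlinarith [sq_nonneg (Real.sin φ), mul_nonneg hε.le h0,
      mul_nonneg (sq_nonneg ε) (sq_nonneg (Real.cos φ))]
  linarith

theorem sqrt_one_sub_sq_mem {x : ℝ} (hx : x ∈ Ioo (0 : ℝ) 1) : √(1 - x ^ 2) ∈ Ioo (0 : ℝ) 1 :=
  ⟨Real.sqrt_pos.2 (by nlinarith [hx.1, hx.2]),
    (Real.sqrt_lt' one_pos).2 (by nlinarith [hx.1, hx.2])⟩

theorem modulusG_strictAntiOn : StrictAntiOn modulusG (Ioo 0 1) := by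
  intro x hx y hy hxy
  have hx' := sqrt_one_sub_sq_mem hx
  have hy' := sqrt_one_sub_sq_mem hy
  have hlt : √(1 - y ^ 2) < √(1 - x ^ 2) :=
    Real.sqrt_lt_sqrt (by nlinarith [hy.1, hy.2]) (by nlinarith [hx.1])
  have h1 := ellipticK_lt_ellipticK hy'.1.le hlt hx'.2
  have h2 := ellipticK_lt_ellipticK hx.1.le hxy hy.2
  have h3 : 0 < ellipticK x := ellipticK_pos (by nlinarith [hx.1, hx.2])
  have h4 : 0 < ellipticK √(1 - y ^ 2) := ellipticK_pos (by nlinarith [hy'.1, hy'.2])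
  exact div_lt_div₀ h1 h2.le (h4.trans h1).le h3

theorem continuousOn_modulusG {a b : ℝ} (ha : 0 < a) (hb : b < 1) :
    ContinuousOn modulusG (Icc a b) := by
  have h1 : ContinuousOn ellipticK (Icc a b) :=
    (continuousOn_ellipticK hb).mono (Icc_subset_Icc_left ha.le)
  have hlt : √(1 - a ^ 2) < 1 := (Real.sqrt_lt' one_pos).2 (by nlinarith)
  refine ContinuousOn.div ((continuousOn_ellipticK hlt).comp (by fun_prop) fun x hx => ?_) h1
    fun x hx => (ellipticK_pos ?_).ne'
  · exact ⟨Real.sqrt_nonneg _, Real.sqrt_le_sqrt (by nlinarith [hx.1])⟩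
  · nlinarith [hx.1, hx.2]

/-- Every ratio in `(0, 1)` is a value of `G`, at a modulus `x ≥ 1/√2`. -/
theorem exists_modulusG_eq {r : ℝ} (hr : r ∈ Ioo (0 : ℝ) 1) :
    ∃ x ∈ Ioo (0 : ℝ) 1, 1 / 2 ≤ x ^ 2 ∧ modulusG x = r := by
  -- The modulus 1/√2 is its own complement, so G equals 1 there.
  set a : ℝ := √(1 / 2) with ha
  have ha2 : a ^ 2 = 1 / 2 := Real.sq_sqrt (by norm_num)
  have ha0 : 0 < a := Real.sqrt_pos.2 (by norm_num)
  have ha1 : a < 1 := by nlinarith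
  have haa : √(1 - a ^ 2) = a := by rw [ha2, ha]; norm_num
  have hM : 0 < ellipticK a := ellipticK_pos (by linarith)
  -- Chosen so that -log ε exceeds K(a)/r; at the modulus complementary to ε the numerator K(ε) is
  -- below K(a), hence G is at most r.
  set ε : ℝ := Real.exp (-(ellipticK a / r + 1)) with hε
  have hε0 : 0 < ε := Real.exp_pos _
  have hq : 0 < ellipticK a / r := div_pos hM hr.1
  have hε2 : ε ≤ 1 / 2 := by
    have h1 : ε ≤ Real.exp (-1) := Real.exp_le_exp.2 (by linarith)
    have h2 : Real.exp (-1) ≤ 1 / 2 := by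
      rw [Real.exp_neg, ← one_div]
      exact one_div_le_one_div_of_le two_pos (by linarith [Real.add_one_le_exp (1 : ℝ)])
    exact h1.trans h2
  set b : ℝ := √(1 - ε ^ 2) with hb
  have hb2 : b ^ 2 = 1 - ε ^ 2 := Real.sq_sqrt (by nlinarith)
  have hb1 : b < 1 := (Real.sqrt_lt' one_pos).2 (by nlinarith)
  have hab : a ≤ b := Real.sqrt_le_sqrt (by nlinarith)
  have hbb : √(1 - b ^ 2) = ε := by rw [hb2, sub_sub_cancel, Real.sqrt_sq hε0.le]
  have hK : ellipticK a / r ≤ ellipticK b := by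
    have := neg_log_le_ellipticK hε0 (by linarith)
    rw [hε, Real.log_exp, neg_neg, ← hε, ← hb] at this
    linarith
  have hGb : modulusG b ≤ r := by
    rw [modulusG, hbb, div_le_iff₀ (lt_of_lt_of_le hq hK)]
    have h1 : ellipticK ε < ellipticK a := ellipticK_lt_ellipticK hε0.le (by nlinarith) ha1
    rw [div_le_iff₀ hr.1] at hK
    linarith
  have hGa : r ≤ modulusG a := by
    rw [modulusG, haa, div_self hM.ne']
    exact hr.2.le
  obtain ⟨x, hx, hxr⟩ := intermediate_value_Icc' hab (continuousOn_modulusG ha0 hb1) ⟨hGb, hGa⟩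
  refine ⟨x, ⟨ha0.trans_le hx.1, hx.2.trans_lt hb1⟩, ?_, hxr⟩
  rw [← ha2]
  exact pow_le_pow_left₀ ha0.le hx.1 2

/-! ### Side lengths of the image rectangle as elliptic integrals -/

theorem norm_one_sub_scRot_sq (θ t : ℝ) :
    ‖1 - scRot θ * (t : ℂ) ^ 2‖ ^ 2 = (1 + t ^ 2) ^ 2 - Real.cos θ ^ 2 * (2 * t) ^ 2 := by
  have h1 := Real.cos_two_mul θ
  have h2 := Real.sin_sq_add_cos_sq (2 * θ)
  rw [Complex.sq_norm, Complex.normSq_apply, ← Complex.ofReal_pow]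
  simp only [Complex.sub_re, Complex.sub_im, Complex.one_re, Complex.one_im, Complex.re_mul_ofReal,
    Complex.im_mul_ofReal, scRot_re, scRot_im]
  linear_combination (t ^ 4) * h2 - 2 * t ^ 2 * h1

theorem scDeriv_ofReal {θ t : ℝ} (ht : (t : ℂ) ∈ scDomain θ) :
    scDeriv θ t = ((‖1 - scRot θ * (t : ℂ) ^ 2‖⁻¹ : ℝ) : ℂ) := by
  have h1 : 1 - scRot (-θ) * (t : ℂ) ^ 2 = conj (1 - scRot θ * (t : ℂ) ^ 2) := by
    rw [map_sub, map_mul, map_pow, map_one, Complex.conj_ofReal, conj_scRot]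
  rw [scDeriv, scLog, h1, Complex.log_conj _ (Complex.slitPlane_arg_ne_pi ht.1), Complex.add_conj,
    Complex.log_re]
  have h2 := norm_pos_iff.2 (Complex.slitPlane_ne_zero ht.1)
  have h3 : -((2 * Real.log ‖1 - scRot θ * (t : ℂ) ^ 2‖ : ℝ) : ℂ) / 2
      = ((-Real.log ‖1 - scRot θ * (t : ℂ) ^ 2‖ : ℝ) : ℂ) := by
    push_cast
    ring
  rw [h3, ← Complex.ofReal_exp, Real.exp_neg, Real.exp_log h2]

/-- The side lengths of the image rectangle are complete elliptic integrals. -/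
theorem scHalfWidth_eq {θ : ℝ} (hθ : θ ∈ Ioo 0 (Real.pi / 2)) :
    scHalfWidth θ = ellipticK (Real.cos θ) / 2 := by
  have hx : Real.cos θ ^ 2 < 1 := by
    have h1 := Real.sin_pos_of_pos_of_lt_pi hθ.1 (by linarith [hθ.2, Real.pi_pos])
    nlinarith [Real.sin_sq_add_cos_sq θ]
  have hone : (1 : ℂ) ∈ scDomain θ := by
    refine mem_scDomain_of_norm_eq_one norm_one ?_
    rw [one_pow, Complex.one_re, Real.cos_two_mul]
    nlinarith
  have hdom : ∀ t ∈ uIcc (0 : ℝ) 1, (t : ℂ) ∈ scDomain θ := fun t ht => by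
    rw [uIcc_of_le zero_le_one] at ht
    simpa using mul_mem_scDomain hone ht
  have h1 : scMap θ 1 = ((∫ t in (0 : ℝ)..1, ‖1 - scRot θ * (t : ℂ) ^ 2‖⁻¹ : ℝ) : ℂ) := by
    rw [scMap, ← intervalIntegral.integral_ofReal]
    refine intervalIntegral.integral_congr fun t ht => ?_
    simp only [one_mul, mul_one]
    exact scDeriv_ofReal (hdom t ht)
  rw [scHalfWidth, h1, Complex.ofReal_re, eq_div_iff two_ne_zero, mul_comm,
    ← intervalIntegral.integral_const_mul]
  -- The substitution φ = 2 arctan t turns the Legendre integrand into twice the reciprocal of |1 -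
  -- e^{2iθ}t²|, by `norm_one_sub_scRot_sq`.
  have hd : ∀ t ∈ uIcc (0 : ℝ) 1,
      HasDerivAt (fun t : ℝ => 2 * Real.arctan t) (2 * (1 / (1 + t ^ 2))) t := fun t _ =>
    (Real.hasDerivAt_arctan t).const_mul 2
  have hc : ContinuousOn (fun t : ℝ => 2 * (1 / (1 + t ^ 2))) (uIcc (0 : ℝ) 1) :=
    Continuous.continuousOn (continuous_const.mul
      (Continuous.div (by fun_prop) (by fun_prop) fun t => by positivity))
  have hsub := intervalIntegral.integral_comp_mul_deriv hd hc (continuous_ellipticK_integrand hx)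
  rw [Real.arctan_zero, Real.arctan_one, mul_zero, show 2 * (Real.pi / 4) = Real.pi / 2 by ring]
    at hsub
  rw [ellipticK, ← hsub]
  refine intervalIntegral.integral_congr fun t ht => ?_
  simp only [Function.comp_apply]
  have hN := norm_pos_iff.2 (Complex.slitPlane_ne_zero (hdom t ht).1)
  have hs : Real.sin (2 * Real.arctan t) = 2 * t / (1 + t ^ 2) := by
    have h2 : (0 : ℝ) ≤ 1 + t ^ 2 := by positivity
    rw [Real.sin_two_mul, Real.sin_arctan, Real.cos_arctan]
    have h3 := Real.mul_self_sqrt h2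
    have h4 : √(1 + t ^ 2) ≠ 0 := (Real.sqrt_pos.2 (by positivity)).ne'
    calc 2 * (t / √(1 + t ^ 2)) * (1 / √(1 + t ^ 2))
        = 2 * t / (√(1 + t ^ 2) * √(1 + t ^ 2)) := by field_simp
      _ = _ := by rw [h3]
  have hroot : √(1 - Real.cos θ ^ 2 * Real.sin (2 * Real.arctan t) ^ 2)
      = ‖1 - scRot θ * (t : ℂ) ^ 2‖ / (1 + t ^ 2) := by
    rw [Real.sqrt_eq_iff_mul_self_eq_of_pos (by positivity), ← pow_two, hs, div_pow, div_pow, norm_one_sub_scRot_sq]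
    field_simp
  rw [hroot]
  field_simp

theorem ratio_scHalfWidth {θ : ℝ} (hθ : θ ∈ Ioo 0 (Real.pi / 2)) :
    scHalfWidth (Real.pi / 2 - θ) / scHalfWidth θ = modulusG (Real.cos θ) := by
  have h1 : √(1 - Real.cos θ ^ 2) = Real.sin θ := by
    rw [← Real.sin_sq, Real.sqrt_sq]
    exact (Real.sin_pos_of_pos_of_lt_pi hθ.1 (by linarith [hθ.2, Real.pi_pos])).le
  rw [scHalfWidth_eq hθ, scHalfWidth_eq (pi_div_two_sub_mem hθ), Real.cos_pi_div_two_sub, modulusG,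
    h1, div_div_div_cancel_right₀ two_ne_zero]

/-! ### Critical points of the Robin function -/

theorem scLogDeriv_zero (θ : ℝ) : scLogDeriv θ 0 = 0 := by simp [scLogDeriv]

theorem scDeriv_zero (θ : ℝ) : scDeriv θ 0 = 1 := by simp [scDeriv, scLog]

theorem hasFDerivAt_neg_log_conformalRadius {θ : ℝ} {c : ℂ} (hc : c ≠ 0) {w : ℂ}
    (hw : w ∈ ball (0 : ℂ) 1) :
    HasFDerivAt (fun b : ℂ => -Real.log (‖c * scDeriv θ b‖ * (1 - ‖b‖ ^ 2)))
      (-(Complex.reCLM.comp (scLogDeriv θ w • (1 : ℂ →L[ℝ] ℂ)) +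
        (1 - ‖w‖ ^ 2)⁻¹ • (-(2 • innerSL ℝ w)))) w := by
  have hpos : ∀ b ∈ ball (0 : ℂ) 1, 0 < 1 - ‖b‖ ^ 2 := fun b hb => by
    nlinarith [mem_ball_zero_iff.1 hb, norm_nonneg b]
  have h1 : HasFDerivAt (fun b => (scLog θ b).re)
      (Complex.reCLM.comp (scLogDeriv θ w • (1 : ℂ →L[ℝ] ℂ))) w :=
    Complex.reCLM.hasFDerivAt.comp w
      (hasDerivAt_scLog (ball_subset_scDomain θ hw)).complexToReal_fderiv
  have h2 : HasFDerivAt (fun b : ℂ => Real.log (1 - ‖b‖ ^ 2))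
      ((1 - ‖w‖ ^ 2)⁻¹ • (-(2 • innerSL ℝ w) : ℂ →L[ℝ] ℝ)) w :=
    ((hasStrictFDerivAt_norm_sq w).hasFDerivAt.const_sub 1).log (hpos w hw).ne'
  have h3 := ((h1.add h2).const_add (Real.log ‖c‖)).neg
  refine h3.congr_of_eventuallyEq ?_
  filter_upwards [mem_ball_nhds hw] with b hb
  have h4 : ‖scDeriv θ b‖ ≠ 0 := norm_ne_zero_iff.2 (scDeriv_ne_zero θ b)
  rw [Real.log_mul (norm_ne_zero_iff.2 (mul_ne_zero hc (scDeriv_ne_zero θ b))) (hpos b hb).ne',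
    norm_mul, Real.log_mul (norm_ne_zero_iff.2 hc) h4]
  simp only [scDeriv, Complex.norm_exp, Real.log_exp, Pi.add_apply, Pi.neg_apply]
  ring

/-- The hypothesis is the critical point equation in the disc coordinate. With r = |w|² and k = cos
2θ it reduces to r w² + w̄² = k(1 + r)r. The imaginary part makes w² real, the real part gives w² =
kr, and then r = |k|r with |k| < 1. -/
theorem eq_zero_of_scLogDeriv_eq {θ : ℝ} (hθ : θ ∈ Ioo 0 (Real.pi / 2)) {w : ℂ}
    (hw : w ∈ ball (0 : ℂ) 1)
    (h : scLogDeriv θ w = ((2 * (1 - ‖w‖ ^ 2)⁻¹ : ℝ) : ℂ) * conj w) : w = 0 := by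
  set r : ℝ := ‖w‖ ^ 2 with hr
  have hr1 : r < 1 := pow_lt_one₀ (norm_nonneg w) (mem_ball_zero_iff.1 hw) two_ne_zero
  have hr0 : 0 ≤ r := sq_nonneg _
  have hww : w * conj w = (r : ℂ) := by rw [Complex.mul_conj', hr]; push_cast; rfl
  have hd := ball_subset_scDomain θ hw
  have hA := Complex.slitPlane_ne_zero hd.1
  have hB := Complex.slitPlane_ne_zero hd.2
  have hr2 : (1 - r : ℂ) ≠ 0 := by exact_mod_cast (sub_pos.2 hr1).ne'
  have hs := scRot_add_neg θ
  have hm := scRot_mul_neg θ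
  rw [scLogDeriv, div_add_div _ _ hA hB, div_eq_iff (mul_ne_zero hA hB)] at h
  set k : ℝ := Real.cos (2 * θ) with hk
  -- Clear denominators, multiply by w̄ and replace w w̄ by r; a factor 2 then drops out.
  have key : (r : ℂ) * w ^ 2 + conj w ^ 2 = ((k * (1 + r) * r : ℝ) : ℂ) := by
    have h1 : (w * (2 * k) - 2 * w * w ^ 2) * (1 - r)
        = 2 * conj w * (1 - 2 * k * w ^ 2 + (w ^ 2) ^ 2) := by
      push_cast at h hs ⊢
      field_simp at h
      linear_combination h + (- w * (1 - r) - 2 * conj w * w ^ 2) * hs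
        + (2 * w ^ 3 * (1 - r) + 2 * conj w * w ^ 4) * hm
    push_cast
    linear_combination (-1 / 2 : ℂ) * conj w * h1 +
      ((k : ℂ) * (1 - r) - w ^ 2 * (1 - r)
        + 2 * k * (w * conj w + r) - w ^ 2 * (w * conj w + r)) * hww
  have hsq := Complex.sq_norm (w ^ 2)
  rw [norm_pow, ← hr, Complex.normSq_apply] at hsq
  have hre := congrArg Complex.re key
  have him := congrArg Complex.im key
  rw [← map_pow] at hre him
  rw [Complex.add_re, Complex.re_ofReal_mul, Complex.conj_re, Complex.ofReal_re] at hre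
  rw [Complex.add_im, Complex.im_ofReal_mul, Complex.conj_im, Complex.ofReal_im] at him
  have hy : (w ^ 2).im = 0 := by
    have : (1 - r) * (w ^ 2).im = 0 := by linarith
    exact (mul_eq_zero.1 this).resolve_left (by linarith)
  have hx : (w ^ 2).re = k * r := by
    have : (1 + r) * ((w ^ 2).re - k * r) = 0 := by linarith
    exact sub_eq_zero.1 ((mul_eq_zero.1 this).resolve_left (by linarith))
  rw [hx, hy] at hsq
  have hk1 : k ^ 2 < 1 := by
    have := Real.sin_sq_add_cos_sq (2 * θ)
    have := sin_two_mul_pos hθ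
    nlinarith
  have h5 : r ^ 2 * (1 - k ^ 2) = 0 := by linarith
  have h6 : r ^ 2 = 0 := (mul_eq_zero.1 h5).resolve_right (by linarith)
  have h7 : r = 0 := pow_eq_zero_iff two_ne_zero |>.1 h6
  exact norm_eq_zero.1 (pow_eq_zero_iff two_ne_zero |>.1 h7)

/-- The Robin function of a rectangle has exactly one critical point, the conformal centre. -/
theorem IsConformalDiscMap.isRobinCriticalPoint_iff {f : ℂ → ℂ} {D : Set ℂ}
    (h : IsConformalDiscMap f D) (hDb : Bornology.IsBounded D) {θ : ℝ}
    (hθ : θ ∈ Ioo 0 (Real.pi / 2)) {c : ℂ} (hc : c ≠ 0)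
    (hf : ∀ z ∈ ball (0 : ℂ) 1, deriv f z = c * scDeriv θ z) {ξ : ℂ} :
    IsRobinCriticalPoint D ξ ↔ ξ = f 0 := by
  have h00 : (0 : ℂ) ∈ ball (0 : ℂ) 1 := Metric.mem_ball_self one_pos
  constructor
  · rintro ⟨hξ, R, hR, hd⟩
    obtain ⟨w, hw, rfl⟩ := h.2.surjOn hξ
    have hRf := (h.isRobinFunction_iff hDb).1 hR
    have h1 := hd.comp w (h.analyticAt hw).differentiableAt.hasDerivAt.complexToReal_fderiv
    have h2 := (hasFDerivAt_neg_log_conformalRadius (θ := θ) hc hw).congr_of_eventuallyEq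
      (f₁ := R ∘ f) (by
        filter_upwards [mem_ball_nhds hw] with b hb
        rw [Function.comp_apply, hRf b hb, hf b hb])
    have h3 := h1.unique h2
    -- The differential of the pulled-back Robin function vanishes in every direction; v = 1 and v =
    -- i give the two components of the complex equation.
    have h4 : ∀ v : ℂ, (scLogDeriv θ w * v).re - (1 - ‖w‖ ^ 2)⁻¹ * (2 * (conj w * v).re) = 0 := by
      intro v
      have h5 := congrArg (fun A : ℂ →L[ℝ] ℝ => A v) h3
      simp [Complex.inner] at h5
      simp only [Complex.mul_re, Complex.conj_re, Complex.conj_im]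
      linarith
    have hw0 : w = 0 := by
      refine eq_zero_of_scLogDeriv_eq hθ hw (Complex.ext ?_ ?_)
      · have h5 := h4 1
        rw [mul_one, mul_one] at h5
        rw [Complex.re_ofReal_mul]
        linarith
      · have h5 := h4 Complex.I
        rw [Complex.mul_I_re, Complex.mul_I_re] at h5
        rw [Complex.im_ofReal_mul]
        linarith
    rw [hw0]
  · rintro rfl
    obtain ⟨g, hgm, hgl, hgr, hgd⟩ := h.exists_inverse
    have hD := h.2.mapsTo h00
    refine ⟨hD, (fun b : ℂ => -Real.log (‖c * scDeriv θ b‖ * (1 - ‖b‖ ^ 2))) ∘ g, ?_, ?_⟩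
    · refine (h.isRobinFunction_iff hDb).2 fun b hb => ?_
      simp only [Function.comp_apply]
      rw [hgl b hb, hf b hb]
    · have h1 := (hasFDerivAt_neg_log_conformalRadius (θ := θ) hc h00).congr_fderiv
        (g' := 0) (by ext v; simp [scLogDeriv_zero])
      rw [← hgl 0 h00] at h1
      have h2 := h1.comp (f 0) (hgd (f 0) hD).complexToReal_fderiv
      rwa [ContinuousLinearMap.zero_comp] at h2

/-! ### The third derivative at the conformal centre -/

theorem hasDerivAt_scLogDeriv_zero (θ : ℝ) :
    HasDerivAt (scLogDeriv θ) ((2 * Real.cos (2 * θ) : ℝ) : ℂ) 0 := by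
  have key : ∀ a : ℂ, HasDerivAt (fun z : ℂ => a * z / (1 - a * z ^ 2)) a 0 := by
    intro a
    have h1 : HasDerivAt (fun z : ℂ => a * z) a 0 := by
      simpa using (hasDerivAt_id (0 : ℂ)).const_mul a
    have h2 : HasDerivAt (fun z : ℂ => 1 - a * z ^ 2) 0 0 := by
      simpa using ((hasDerivAt_pow 2 (0 : ℂ)).const_mul a).const_sub 1
    refine HasDerivAt.congr_deriv (h1.div h2 (by simp)) (by simp)
  rw [← scRot_add_neg]
  exact (key _).add (key _)

/-- Since the logarithmic derivative vanishes at 0, F'''/F' there is just its first derivative, 2cos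
2θ, times the unimodular factor C² from the rotation. -/
theorem norm_iteratedDeriv_three_div_deriv {F : ℂ → ℂ} {θ : ℝ} {c C : ℂ} (hc : c ≠ 0)
    (hC : ‖C‖ = 1) (hF : ∀ z ∈ ball (0 : ℂ) 1, deriv F z = c * scDeriv θ (C * z)) :
    ‖iteratedDeriv 3 F 0 / deriv F 0‖ = |2 * Real.cos (2 * θ)| := by
  have h00 : (0 : ℂ) ∈ ball (0 : ℂ) 1 := Metric.mem_ball_self one_pos
  have hlin : ∀ z : ℂ, HasDerivAt (fun z => C * z) C z := fun z => by
    simpa using (hasDerivAt_id z).const_mul C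
  have h2 : deriv (deriv F) =ᶠ[𝓝 0]
      fun z => c * (scDeriv θ (C * z) * scLogDeriv θ (C * z) * C) := by
    filter_upwards [mem_ball_nhds h00] with z hz
    have hz' : C * z ∈ ball (0 : ℂ) 1 := by
      rw [mem_ball_zero_iff, norm_mul, hC, one_mul]
      exact mem_ball_zero_iff.1 hz
    have h3 := ((hasDerivAt_scDeriv (ball_subset_scDomain θ hz')).comp z (hlin z)).const_mul c
    refine (h3.congr_of_eventuallyEq ?_).deriv
    filter_upwards [mem_ball_nhds hz] with y hy using hF y hy
  have h3 : deriv (deriv (deriv F)) 0 = c * (((2 * Real.cos (2 * θ) : ℝ) : ℂ) * C * C) := by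
    rw [h2.deriv_eq]
    have hq : HasDerivAt (fun z => scLogDeriv θ (C * z))
        (((2 * Real.cos (2 * θ) : ℝ) : ℂ) * C) 0 := by
      have h4 := hasDerivAt_scLogDeriv_zero θ
      rw [← mul_zero C] at h4
      exact h4.comp 0 (hlin 0)
    have hg : HasDerivAt (fun z => scDeriv θ (C * z))
        (scDeriv θ (C * 0) * scLogDeriv θ (C * 0) * C) 0 := by
      refine (hasDerivAt_scDeriv (ball_subset_scDomain θ ?_)).comp 0 (hlin 0)
      rwa [mul_zero]
    refine HasDerivAt.deriv (HasDerivAt.congr_deriv (((hg.mul hq).mul_const C).const_mul c) ?_)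
    simp only [mul_zero, scDeriv_zero, scLogDeriv_zero]
    ring
  have h4 : iteratedDeriv 3 F 0 = deriv (deriv (deriv F)) 0 := by
    simp only [iteratedDeriv_succ, iteratedDeriv_zero]
  rw [h4, h3, hF 0 h00, mul_zero, scDeriv_zero, mul_one, mul_div_cancel_left₀ _ hc, norm_mul,
    norm_mul, hC, mul_one, mul_one, Complex.norm_real, Real.norm_eq_abs]

/-! ### Rectangles in general position and the conclusion -/

theorem IsConformalDiscMap.const_mul_add {f : ℂ → ℂ} {D : Set ℂ} (h : IsConformalDiscMap f D)
    {a : ℂ} (ha : a ≠ 0) (b : ℂ) :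
    IsConformalDiscMap (fun z => b + a * f z) ((fun w => b + a * w) '' D) := by
  refine ⟨(h.1.const_mul a).const_add b, ?_⟩
  have hinj : Function.Injective fun w : ℂ => b + a * w := fun x y hxy =>
    mul_left_cancel₀ ha (add_left_cancel hxy)
  exact (hinj.injOn.bijOn_image (s := D)).comp h.2

theorem image_reProdIm_eq_openRectangle {X Y κ : ℝ} (hκ : 0 < κ) (p u : ℂ) :
    (fun w : ℂ => (p + u * ((κ * X : ℝ) + (κ * Y : ℝ) * Complex.I)) + (u * κ) * w) ''
      (Ioo (-X) X ×ℂ Ioo (-Y) Y) = openRectangle p u (2 * κ * X) (2 * κ * Y) := by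
  ext z
  constructor
  · rintro ⟨w, ⟨⟨h1, h2⟩, h3, h4⟩, rfl⟩
    refine ⟨κ * X + κ * w.re, ⟨by nlinarith, by nlinarith⟩, κ * Y + κ * w.im,
      ⟨by nlinarith, by nlinarith⟩, ?_⟩
    conv_lhs => rw [← Complex.re_add_im w]
    push_cast
    ring
  · rintro ⟨s, ⟨hs1, hs2⟩, t, ⟨ht1, ht2⟩, rfl⟩
    refine ⟨⟨s / κ - X, t / κ - Y⟩, ⟨⟨?_, ?_⟩, ⟨?_, ?_⟩⟩, ?_⟩
    · have : 0 < s / κ := div_pos hs1 hκ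
      simp only
      linarith
    · have : s / κ < 2 * X := by rw [div_lt_iff₀ hκ]; linarith
      simp only
      linarith
    · have : 0 < t / κ := div_pos ht1 hκ
      simp only
      linarith
    · have : t / κ < 2 * Y := by rw [div_lt_iff₀ hκ]; linarith
      simp only
      linarith
    · have hκ' : (κ : ℂ) ≠ 0 := by exact_mod_cast hκ.ne'
      simp only [Complex.mk_eq_add_mul_I]
      push_cast
      field_simp
      ring

theorem isBounded_openRectangle (p u : ℂ) (L l : ℝ) :
    Bornology.IsBounded (openRectangle p u L l) := by
  have hc : IsCompact ((fun q : ℝ × ℝ => p + u * ((q.1 : ℂ) + (q.2 : ℂ) * Complex.I)) ''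
      (Icc 0 L ×ˢ Icc 0 l)) :=
    (isCompact_Icc.prod isCompact_Icc).image (by fun_prop)
  refine hc.isBounded.subset ?_
  rintro z ⟨s, hs, t, ht, rfl⟩
  exact ⟨(s, t), ⟨Ioo_subset_Icc_self hs, Ioo_subset_Icc_self ht⟩, rfl⟩

/-- The modulus that enters `rectangleG`. -/
theorem sqrt_half_one_add_mem {n : ℕ} (hn : 1 ≤ n) :
    √((1 + √(1 - 1 / (n : ℝ) ^ 2)) / 2) ∈ Ioo (0 : ℝ) 1 := by
  have hn0 : (0 : ℝ) < n := by exact_mod_cast hn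
  have h1 : √(1 - 1 / (n : ℝ) ^ 2) < 1 := by
    rw [Real.sqrt_lt' one_pos]
    have : 0 < 1 / (n : ℝ) ^ 2 := by positivity
    linarith
  have h0 := Real.sqrt_nonneg (1 - 1 / (n : ℝ) ^ 2)
  refine ⟨Real.sqrt_pos.2 (by linarith), ?_⟩
  rw [Real.sqrt_lt' one_pos]
  linarith

/-- With x = cos θ the left side is 2cos 2θ. Solving for x gives the modulus in `rectangleG n`, and
G is injective on (0, 1). -/
theorem two_mul_sq_sub_one_eq_iff {x : ℝ} (hx : x ∈ Ioo (0 : ℝ) 1) {n : ℕ} (hn : 1 ≤ n) :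
    2 * (2 * x ^ 2 - 1) = 2 * √(1 - 1 / (n : ℝ) ^ 2) ↔ modulusG x = rectangleG n := by
  have hy := sqrt_half_one_add_mem hn
  have h0 := Real.sqrt_nonneg (1 - 1 / (n : ℝ) ^ 2)
  rw [rectangleG, modulusG_strictAntiOn.injOn.eq_iff hx hy, eq_comm (a := x),
    Real.sqrt_eq_iff_mul_self_eq_of_pos hx.1]
  constructor <;> intro h <;> linarith

/-- The conformal map onto a rectangle, together with its modulus. -/
theorem exists_conformalMap_openRectangle {l L : ℝ} (hl : 0 < l) (hlL : l < L) (p : ℂ) {u : ℂ}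
    (hu : ‖u‖ = 1) :
    ∃ x ∈ Ioo (0 : ℝ) 1, 1 / 2 ≤ x ^ 2 ∧ modulusG x = l / L ∧ ∃ θ ∈ Ioo 0 (Real.pi / 2),
      Real.cos θ = x ∧ ∃ (f : ℂ → ℂ) (c : ℂ), c ≠ 0 ∧
        IsConformalDiscMap f (openRectangle p u L l) ∧
        ∀ z ∈ ball (0 : ℂ) 1, HasDerivAt f (c * scDeriv θ z) z := by
  have hL : 0 < L := hl.trans hlL
  obtain ⟨x, hx, hx2, hG⟩ := exists_modulusG_eq (r := l / L) ⟨div_pos hl hL, (div_lt_one hL).2 hlL⟩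
  have hcos : Real.cos (Real.arccos x) = x := Real.cos_arccos (by linarith [hx.1]) hx.2.le
  have hθ : Real.arccos x ∈ Ioo 0 (Real.pi / 2) :=
    ⟨Real.arccos_pos.2 hx.2, Real.arccos_lt_pi_div_two.2 hx.1⟩
  refine ⟨x, hx, hx2, hG, Real.arccos x, hθ, hcos, ?_⟩
  generalize Real.arccos x = θ at hcos hθ
  have hratio := ratio_scHalfWidth hθ
  rw [hcos, hG] at hratio
  have hX := scHalfWidth_pos hθ
  have hconf := isConformalDiscMap_scMap hθ
  set X := scHalfWidth θ
  set Y := scHalfWidth (Real.pi / 2 - θ)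
  -- The scale is fixed by the side L; the other side then has length l because the ratio of the
  -- half-widths is G(x) = l/L.
  set κ : ℝ := L / (2 * X) with hκdef
  have hκ : 0 < κ := by positivity
  have hLX : 2 * κ * X = L := by rw [hκdef]; field_simp
  have hlY : 2 * κ * Y = l := by
    rw [div_eq_div_iff hX.ne' hL.ne'] at hratio
    rw [hκdef]
    field_simp
    linarith
  have hc : u * (κ : ℂ) ≠ 0 :=
    mul_ne_zero (norm_ne_zero_iff.1 (by rw [hu]; exact one_ne_zero)) (by exact_mod_cast hκ.ne')
  have himg := image_reProdIm_eq_openRectangle (X := X) (Y := Y) hκ p u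
  rw [hLX, hlY] at himg
  refine ⟨_, _, hc, himg ▸ hconf.const_mul_add hc
    (p + u * ((κ * X : ℝ) + (κ * Y : ℝ) * Complex.I)), fun z hz => ?_⟩
  exact ((hasDerivAt_scMap (ball_subset_scDomain θ hz)).const_mul _).const_add _

theorem proposition5p3 (l L : ℝ) (hl : 0 < l) (hlL : l < L) (p u : ℂ) (hu : ‖u‖ = 1) :
    (∃! ξ₀ : ℂ, IsRobinCriticalPoint (openRectangle p u L l) ξ₀) ∧
    (∃ F : ℂ → ℂ, IsConformalDiscMap F (openRectangle p u L l) ∧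
      IsRobinCriticalPoint (openRectangle p u L l) (F 0)) ∧
    ∀ F : ℂ → ℂ, IsConformalDiscMap F (openRectangle p u L l) →
      IsRobinCriticalPoint (openRectangle p u L l) (F 0) →
      (NonDegenerate F ↔ l / L ∉ {x : ℝ | ∃ n : ℕ, 1 ≤ n ∧ x = rectangleG n}) := by
  obtain ⟨x, hx, hx2, hG, θ, hθ, hcos, f, c, hc, hf, hfd⟩ :=
    exists_conformalMap_openRectangle hl hlL p hu
  have hcrit : ∀ {ξ : ℂ}, IsRobinCriticalPoint (openRectangle p u L l) ξ ↔ ξ = f 0 :=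
    hf.isRobinCriticalPoint_iff (isBounded_openRectangle p u L l) hθ hc
      fun z hz => (hfd z hz).deriv
  refine ⟨⟨f 0, hcrit.2 rfl, fun ξ hξ => hcrit.1 hξ⟩, ⟨f, hf, hcrit.2 rfl⟩, fun F hF hF0 => ?_⟩
  obtain ⟨C, hC, hFC⟩ := hF.exists_rotation hf (hcrit.1 hF0)
  have hC0 : C ≠ 0 := norm_ne_zero_iff.1 (by rw [hC]; exact one_ne_zero)
  have hFd : ∀ z ∈ ball (0 : ℂ) 1, deriv F z = (c * C) * scDeriv θ (C * z) := by
    intro z hz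
    have hz' : C * z ∈ ball (0 : ℂ) 1 := by
      rw [mem_ball_zero_iff, norm_mul, hC, one_mul]
      exact mem_ball_zero_iff.1 hz
    have h1 : HasDerivAt (fun z => C * z) C z := by simpa using (hasDerivAt_id z).const_mul C
    have h2 : HasDerivAt F (c * scDeriv θ (C * z) * C) z :=
      ((hfd _ hz').comp z h1).congr_of_eventuallyEq
        (hFC.eventuallyEq_of_mem (mem_ball_nhds hz))
    rw [h2.deriv]
    ring
  have hnorm := norm_iteratedDeriv_three_div_deriv (mul_ne_zero hc hC0) hC hFd
  -- The absolute value disappears because x² ≥ 1/2.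
  rw [Real.cos_two_mul, hcos, abs_of_nonneg (by linarith)] at hnorm
  rw [NonDegenerate, hnorm, ← hG, not_iff_not]
  exact exists_congr fun n => and_congr_right fun hn => two_mul_sq_sub_one_eq_iff hx hn
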